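/- Let $u\ge 2$ and $v\ge 1$ be coprime integers such that the admissible level $k=-2+\frac uv$ is negative. Put $t=k+2=\frac uv$, $w=-kv=2v-u$ and $\tilde c=2-\frac6t$. Let $\tau$ be in the upper half-plane $\mathbb H$, $q^x=e^{2\pi i x\tau}$, $z^x=e^{2\pi i x\zeta}$, let $\eta$ be Dedekind's eta function, and define $$\chi_{r,s}(\tau)=\frac1{\eta(\tau)}\sum_{n\in\mathbb Z}\Bigl[q^{(2uvn+vr-us)^2/4uv}-q^{(2uvn+vr+us)^2/4uv}\Bigr]$$ (the irreducible characters of the Virasoro minimal model with parameters $(u,v)$), and, for $a\in\mathbb R$, $$\vartheta_{a}(\zeta\mid\tau)=\sum_{x\in a+2w\mathbb Z}z^{x}q^{-x^2/4k},\qquad \vartheta'_{a}(\tau)=-\frac{1}{2\pi i\cdot 2w}\,\partial_\zeta\vartheta_{a}(\zeta\mid\tau)\Big|_{\zeta=0}.$$ For $r\in\{1,\dots,u-1\}$ and $\mu\in\mathbb Z$ with $\mu\equiv r-1\pmod 2$ let $$\Gamma_{\mu;r}(\tau)=\sum_{s=1}^{v-1}(-1)^{s-1}\frac{\chi_{r,s}(\tau)}{\eta(\tau)}\bigl[\vartheta'_{\mu+sk}(\tau)-\vartheta'_{\mu-sk}(\tau)\bigr].$$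 (These functions are called the weight-$1$ parts of the atypical irreducible characters of the extended parafermion vertex operator algebra at level $k$.) Let $V_k$ be the complex vector space of functions on $\mathbb H$ spanned by all the $\Gamma_{\mu;r}$, and let $\mathbf B_k$ be the set of pairs $(\mu;r)$ with $r\in\{1,\dots,u-1\}$, $\mu\in\mathbb Z$, $\mu\equiv r-1\pmod 2$ and either $r<\frac u2$ and $0\le\mu\le w$, or $r=\frac u2$ and $0\le\mu\le\frac w2$. **Theorem.** The space $V_k$ is finite-dimensional, with $\dim V_k\le|\mathbf B_k|$, and its elements define a vector-valued modular form of weight $1$: for every basis $F=(F_1,\dots,F_n)$ of $V_k$ there is a homomorphism $\rho:SL_2(\mathbb Z)\to GL_n(\mathbb C)$ with $F|_1\gamma=\rho(\gamma)F$ for all $\gamma\in SL_2(\mathbb Z)$, where $(F|_1\gamma)(\tau)=(c\tau+d)^{-1}F\bigl(\tfrac{a\tau+b}{c\tau+d}\bigr)$ for $\gamma=\begin{pmatrix}a&b\\c&d\end{pmatrix}$, and every $F_i$ is holomorphic on $\mathbb H$ and satisfies $F_i(\tau)=O(e^{N\operatorname{Im}\tau})$ as $\operatorname{Im}\tau\to\infty$,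 for some real $N$. Moreover, for all $r\in\{1,\dots,u-1\}$, all integers $\mu\equiv r-1\pmod 2$ and all $\tau\in\mathbb H$, $$\Gamma_{\mu;r}(-1/\tau)=-i\tau\sum_{(\mu';r')\in\mathbf B_k}S_{(\mu;r)(\mu';r')}\,\Gamma_{\mu';r'}(\tau),\qquad \Gamma_{\mu;r}(\tau+1)=e^{2\pi i(\Delta_{\mu;r}-\tilde c/24)}\,\Gamma_{\mu;r}(\tau),$$ where $$S_{(\mu;r)(\mu';r')}=\frac{2A_{\mu';r'}}{\sqrt{uw}}\,\sin\frac{\pi rr'}{t}\,\cos\frac{\pi\mu\mu'}{k},\qquad A_{\mu';r'}=\begin{cases}1&\text{if } r'=\frac u2 \text{ and } \mu'\in\frac w2\mathbb Z,\\ 1&\text{if } r'\ne\frac u2\text{ and }\mu'\in w\mathbb Z,\\ 2&\text{otherwise,}\end{cases}$$ and $\Delta_{\mu;r}$ is the conformal weight of the ground states of the corresponding parafermion module, that is $\Delta_{\mu;r}=\frac{r^2-1}{4t}-\frac{\mu^2}{4k}$ if $|\mu|\le r-1$ and $\Delta_{\mu;r}=\frac{r^2-1}{4t}-\frac{\mu^2}{4k}+\frac{|\mu|-(r-1)}2$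 if $|\mu|\ge r-1$. -/

import Mathlib

open scoped UpperHalfPlane ModularForm MatrixGroups Manifold

noncomputable section

namespace LogParafermion

/-- The parameter `t = k + 2 = u / v` of the admissible level `k`. -/
def tParam (u v : ℕ) : ℝ := (u : ℝ) / v

/-- The admissible level `k = -2 + u / v`. -/
def level (u v : ℕ) : ℝ := -2 + (u : ℝ) / v

/-- The integer `w = -k v = 2 v - u`. -/
def wParam (u v : ℕ) : ℤ := 2 * (v : ℤ) - u

/-- The central charge `2 - 6 / t` of the parafermion coset. -/
def centralCharge (u v : ℕ) : ℝ := 2 - 6 / tParam u v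

/-- The power `q ^ x` with `q = exp (2 π i τ)`. -/
def qPow (x : ℝ) (τ : ℂ) : ℂ := Complex.exp (2 * Real.pi * Complex.I * x * τ)

/-- The character of the irreducible module `(r, s)` of the Virasoro minimal model with
parameters `(u, v)`. -/
def virChar (u v r s : ℕ) (τ : ℂ) : ℂ :=
  (ModularForm.eta τ)⁻¹ * ∑' n : ℤ,
    (qPow ((2 * u * v * n + v * r - u * s) ^ 2 / (4 * u * v)) τ
      - qPow ((2 * u * v * n + v * r + u * s) ^ 2 / (4 * u * v)) τ)

/-- The theta function `∑ z ^ x q ^ (-x ^ 2 / 4 k)`, summed over `x` in the coset `a + L` of the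
lattice `L = 2 w ℤ`, where `z = exp (2 π i ζ)` and `q = exp (2 π i τ)`. -/
def latticeTheta (u v : ℕ) (a : ℝ) (ζ τ : ℂ) : ℂ :=
  ∑' n : ℤ,
    Complex.exp (2 * Real.pi * Complex.I * ζ * ((a + 2 * wParam u v * n : ℝ) : ℂ))
      * qPow (-(a + 2 * wParam u v * n) ^ 2 / (4 * level u v)) τ

/-- The derivative `-(z ∂_z) / (2 w)` of the theta function, at `z = 1`. Recall that
`z ∂_z = (2 π i)⁻¹ ∂_ζ`. -/
def thetaDeriv (u v : ℕ) (a : ℝ) (τ : ℂ) : ℂ :=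
  -(2 * Real.pi * Complex.I * (2 * wParam u v))⁻¹ * deriv (fun ζ => latticeTheta u v a ζ τ) 0

/-- The weight one part of the atypical irreducible character labelled by `(μ; r)`. -/
def gammaFn (u v : ℕ) (μ : ℤ) (r : ℕ) (τ : ℂ) : ℂ :=
  ∑ s ∈ Finset.Icc 1 (v - 1), (-1) ^ (s - 1) * (virChar u v r s τ / ModularForm.eta τ)
    * (thetaDeriv u v (μ + s * level u v) τ - thetaDeriv u v (μ - s * level u v) τ)

/-- The labels `(μ; r)`: `1 ≤ r ≤ u - 1` and `μ` is an integer with `μ = r - 1` modulo `2`. -/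
def IsLabel (u : ℕ) (μ : ℤ) (r : ℕ) : Prop :=
  1 ≤ r ∧ r ≤ u - 1 ∧ μ ≡ (r : ℤ) - 1 [ZMOD 2]

/-- The complex vector space spanned by all the weight one parts, as functions on the upper
half-plane. -/
def gammaSpace (u v : ℕ) : Submodule ℂ (ℍ → ℂ) :=
  Submodule.span ℂ {f | ∃ μ r, IsLabel u μ r ∧ f = fun τ : ℍ => gammaFn u v μ r τ}

/-- The index set `B_k`: labels with `0 ≤ μ ≤ w` and `r < u / 2`, or with `0 ≤ μ ≤ w / 2` and
`r = u / 2` (the latter only when `u` is even). -/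
def indexSet (u v : ℕ) : Finset (ℤ × ℕ) :=
  (Finset.Icc 0 (wParam u v) ×ˢ Finset.Icc 1 (u - 1)).filter fun p =>
    p.1 ≡ (p.2 : ℤ) - 1 [ZMOD 2] ∧
      (2 * p.2 < u ∨ (2 * p.2 = u ∧ 2 * p.1 ≤ wParam u v))

/-- The multiplicity `A_{μ; r}`. It is `1` if `r = u / 2` and `μ` is a multiple of `w / 2`, or if
`r ≠ u / 2` and `μ` is a multiple of `w`; otherwise it is `2`. -/
def multA (u v : ℕ) (μ : ℤ) (r : ℕ) : ℝ :=
  if (2 * r = u ∧ wParam u v ∣ 2 * μ) ∨ (2 * r ≠ u ∧ wParam u v ∣ μ) then 1 else 2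

/-- The entry of the S-matrix in row `(μ; r)` and column `(μ'; r')`. -/
def sMatrix (u v : ℕ) (μ : ℤ) (r : ℕ) (μ' : ℤ) (r' : ℕ) : ℝ :=
  2 * multA u v μ' r' / √(u * wParam u v)
    * Real.sin (Real.pi * r * r' / tParam u v)
    * Real.cos (Real.pi * μ * μ' / level u v)

/-- The conformal weight of the ground states of the atypical irreducible parafermion module
labelled by `(μ; r)`. Here `r - 1` is the `sl(2)`-weight `λ_{r,0}` and `(r ^ 2 - 1) / (4 t)` is
the conformal weight `Δ_{r,0}`. -/
def confWeight (u v : ℕ) (μ : ℤ) (r : ℕ) : ℝ :=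
  if |(μ : ℝ)| ≤ r - 1 then
    (r ^ 2 - 1) / (4 * tParam u v) - μ ^ 2 / (4 * level u v)
  else
    (r ^ 2 - 1) / (4 * tParam u v) - μ ^ 2 / (4 * level u v) + (|(μ : ℝ)| - (r - 1)) / 2

/-- The tuple `F` of functions on the upper half-plane is a (weakly holomorphic) vector-valued
modular form of weight `m` for `SL(2, ℤ)` and the representation `ρ`: its components are
holomorphic, they grow at most like a power of `|q|⁻¹` at the cusp, and `F ∣[m] γ = ρ(γ) F`. -/
structure IsVectorValuedModularForm {ι : Type} [Fintype ι] [DecidableEq ι] (m : ℤ)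
    (ρ : SL(2, ℤ) →* GL ι ℂ) (F : ι → ℍ → ℂ) : Prop where
  holomorphic : ∀ i, MDifferentiable 𝓘(ℂ) 𝓘(ℂ) (F i)
  growth : ∀ i, ∃ N : ℝ,
    F i =O[UpperHalfPlane.atImInfty] fun τ : ℍ => Real.exp (N * τ.im)
  slash : ∀ (γ : SL(2, ℤ)) (i : ι),
    F i ∣[m] γ = ∑ j, (ρ γ : Matrix ι ι ℂ) i j • F j

end LogParafermion

end

/-!
The weight one parts are quotients by `η ^ 2` of theta functions of a rank two lattice, and the
theorem is the modularity of these theta functions.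

Write `w = 2 v - u`, so that `k = -w / v` and `u + w = 2 v`. The numerator of the Virasoro
character is a difference of theta series of level `u v`, and the differentiated theta functions
are theta series of level `w v` with the linear weight `j`; see `virChar_eq` and `thetaDeriv_eq`.
Multiplying them and summing over `s` modulo `2 v` gives the function
`cosetTheta u v w μ r = ∑ (-1) ^ s Θ(v r - u s) Ψ(v μ - w s)`, and `Γ η ^ 2` is, up to a constant,
the combination `oddTheta` of two of these, which is even in `μ` and odd in `r` (`gammaFn_eq`).

Under `τ ↦ -1 / τ` each rank one series turns, by the functional equation of the Jacobi theta
function, into a series over all of `ℤ` with character coefficients. Expanding the products as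
double series `doubleTheta`, the inversion formula `cosetTheta_inversion` becomes an identity
between coefficient functions on `ℤ × ℤ`: the characters supported on `a + b ≡ v` modulo `2 v` are
finite Fourier sums of the signed indicator functions of the cosets (`sum_thetaCoeff`). This is
where the coprimality of `u` and `v` enters. Symmetrising in `r'` and `μ'` yields the kernel of sines and
cosines (`oddTheta_inversion`), and the symmetry `(μ; r) ↦ (w - μ; u - r)` folds the sum over a
period box onto the index set, the multiplicities `A` being the effect of the stabilizers
(`sum_box_eq_sum_indexSet`). Under `τ ↦ τ + 1` every summand of `cosetTheta` acquires the same
factor, because `μ + r` is odd.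

The remaining assertions are formal. Slashing by `S` is injective and maps the space into the span
of the functions labelled by the index set, which bounds the dimension; a finite-dimensional space
stable under `S` and `T` is stable under the modular group, and a basis transforms by a matrix
representation. Growth at the cusp follows from the boundedness of the double theta series and the
lower bound for the discriminant `η ^ 24`.
-/

noncomputable section

namespace LogParafermion

/-! ### Periodic functions and finite sums -/

/-- A sum over a period, restricted to one residue class. -/
lemma sum_range_dvd_sub {n : ℕ} (hn : 0 < n) {F : ℤ → ℂ} (hF : Function.Periodic F n) (x₀ : ℤ) :
    ∑ x ∈ Finset.range n, (if (n : ℤ) ∣ x₀ - x then F x else 0) = F x₀ := by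
  have hn' : (0 : ℤ) < n := by exact_mod_cast hn
  have h0 := Int.emod_nonneg x₀ hn'.ne'
  have h1 := Int.emod_lt_of_pos x₀ hn'
  have h2 := Int.mul_ediv_add_emod x₀ n
  have hcast : (((x₀ % n).toNat : ℕ) : ℤ) = x₀ % n := Int.toNat_of_nonneg h0
  rw [Finset.sum_eq_single (x₀ % n).toNat]
  · rw [hcast, if_pos (Int.dvd_self_sub_emod)]
    have := hF.int_mul (x₀ / n) (x₀ % n)
    rw [← this]
    congr 1
    simp only [Int.cast_id]
    linarith
  · intro b hb hne
    rw [if_neg]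
    intro hd
    apply hne
    have hb' : (b : ℤ) < n := by exact_mod_cast Finset.mem_range.mp hb
    have : x₀ % n = b := by
      have := (Int.modEq_iff_dvd.mpr hd).symm
      rwa [Int.ModEq, Int.emod_eq_of_lt (Int.natCast_nonneg b) hb'] at this
    omega
  · intro h
    exact absurd (Finset.mem_range.mpr (by omega)) h

/-- Reindexing a sum over a period by a map that induces a bijection of residue classes. -/
lemma sum_range_eq_sum_zmod {n : ℕ} [NeZero n] {f : ℤ → ℂ} (hf : Function.Periodic f n)
    (e : ZMod n ≃ ZMod n) (g : ℤ → ℤ) (hg : ∀ x : ℤ, ((g x : ℤ) : ZMod n) = e x) :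
    ∑ x ∈ Finset.range n, f (g x) = ∑ x ∈ Finset.range n, f x := by
  -- a periodic function factors through `ZMod n`
  let F : ZMod n → ℂ := fun x => f x.val
  have hF : ∀ x : ℤ, F x = f x := by
    intro x
    simp only [F]
    rw [ZMod.val_intCast]
    have := hf.int_mul (x / n) (x % n)
    rw [← this]
    congr 1
    have h2 := Int.mul_ediv_add_emod x n
    simp only [Int.cast_id]
    linarith
  have key : ∀ H : ZMod n → ℂ, ∑ x ∈ Finset.range n, H ((x : ℤ) : ZMod n) = ∑ x, H x := by
    intro H
    refine Finset.sum_bij' (fun x _ => ((x : ℤ) : ZMod n)) (fun x _ => x.val) ?_ ?_ ?_ ?_ ?_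
    · simp
    · intro a _; simpa using ZMod.val_lt a
    · intro a ha
      simpa using ZMod.val_cast_of_lt (Finset.mem_range.mp ha)
    · intro a _; simp
    · simp
  simp_rw [← hF, hg]
  rw [key (fun x => F (e x)), key F, Equiv.sum_comp]

lemma sum_range_add {n : ℕ} (hn : 0 < n) {f : ℤ → ℂ} (hf : Function.Periodic f n) (c : ℤ) :
    ∑ x ∈ Finset.range n, f (x + c) = ∑ x ∈ Finset.range n, f x := by
  have : NeZero n := ⟨hn.ne'⟩
  exact sum_range_eq_sum_zmod hf (Equiv.addRight (c : ZMod n)) (fun x => x + c) (by simp)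

lemma sum_range_neg {n : ℕ} (hn : 0 < n) {f : ℤ → ℂ} (hf : Function.Periodic f n) :
    ∑ x ∈ Finset.range n, f (-x) = ∑ x ∈ Finset.range n, f x := by
  have : NeZero n := ⟨hn.ne'⟩
  exact sum_range_eq_sum_zmod hf (Equiv.neg (ZMod n)) (fun x => -x) (by simp)

lemma sum_range_two_mul {n : ℕ} {f : ℤ → ℂ} (hf : Function.Periodic f n) :
    ∑ x ∈ Finset.range (2 * n), f x = 2 * ∑ x ∈ Finset.range n, f x := by
  rw [two_mul n, Finset.sum_range_add, two_mul]
  congr 1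
  refine Finset.sum_congr rfl fun x _ => ?_
  rw [← hf x, add_comm]; push_cast; rfl

/-- The sum of an even periodic function over a period, folded onto half a period. -/
lemma sum_range_two_mul_of_even {n : ℕ} (hn : 0 < n) {f : ℤ → ℂ}
    (hf : Function.Periodic f (2 * n : ℕ)) (he : ∀ x, f (-x) = f x) :
    ∑ x ∈ Finset.range (2 * n), f x = f 0 + f n + 2 * ∑ x ∈ Finset.Icc 1 (n - 1), f x := by
  obtain ⟨m, rfl⟩ : ∃ m, n = m + 1 := ⟨n - 1, by omega⟩
  have h2 : ∑ x ∈ Finset.range (m + 1), f ((m + 1 + x : ℕ) : ℤ)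
      = ∑ x ∈ Finset.range (m + 1), f ((x + 1 : ℕ) : ℤ) := by
    rw [← Finset.sum_range_reflect]
    refine Finset.sum_congr rfl fun x hx => ?_
    have hx' := Finset.mem_range.mp hx
    rw [← he, ← hf]
    congr 1
    push_cast
    omega
  have h3 : Finset.Icc 1 (m + 1 - 1) = Finset.Ico 1 (m + 1) := by ext; simp
  rw [two_mul (m + 1), Finset.sum_range_add, h2, h3, Finset.sum_range_succ',
    Finset.sum_range_succ (fun x => f ((x + 1 : ℕ) : ℤ)),
    Finset.sum_Ico_eq_sum_range]
  simp only [add_tsub_cancel_right, add_comm 1]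
  push_cast
  ring

/-! ### Additive characters of finite cyclic groups -/

/-- The additive character `k ↦ exp (2 π i k / n)` of `ℤ / n ℤ`, as a function on `ℤ`. -/
def addChr (n : ℕ) (k : ℤ) : ℂ := Complex.exp (2 * Real.pi * Complex.I * k / n)

lemma addChr_add (n : ℕ) (k l : ℤ) : addChr n (k + l) = addChr n k * addChr n l := by
  rw [addChr, addChr, addChr, ← Complex.exp_add]; congr 1; push_cast; ring

lemma addChr_eq_one_iff {n : ℕ} (hn : 0 < n) (k : ℤ) : addChr n k = 1 ↔ (n : ℤ) ∣ k := by
  have hn' : (n : ℂ) ≠ 0 := by exact_mod_cast hn.ne'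
  rw [addChr, Complex.exp_eq_one_iff]
  constructor
  · rintro ⟨m, hm⟩
    refine ⟨m, ?_⟩
    have h2 := Complex.two_pi_I_ne_zero
    have : (2 * Real.pi * Complex.I) * (k : ℂ) = (2 * Real.pi * Complex.I) * (n * m) := by
      field_simp at hm
      linear_combination (2 * Real.pi * Complex.I) * hm
    exact_mod_cast mul_left_cancel₀ h2 this
  · rintro ⟨m, rfl⟩
    refine ⟨m, ?_⟩
    push_cast
    field_simp

lemma addChr_of_dvd {n : ℕ} (hn : 0 < n) {k : ℤ} (h : (n : ℤ) ∣ k) : addChr n k = 1 :=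
  (addChr_eq_one_iff hn k).mpr h

lemma addChr_congr {n : ℕ} (hn : 0 < n) {k l : ℤ} (h : (n : ℤ) ∣ k - l) :
    addChr n k = addChr n l := by
  rw [← sub_add_cancel k l, addChr_add, addChr_of_dvd hn h, one_mul]

lemma addChr_mul_left {m : ℕ} (hm : 0 < m) (n : ℕ) (k : ℤ) :
    addChr (m * n) (m * k) = addChr n k := by
  have hm' : (m : ℂ) ≠ 0 := by exact_mod_cast hm.ne'
  rw [addChr, addChr]
  congr 1
  push_cast
  rw [← mul_div_mul_left _ (n : ℂ) hm']
  ring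

lemma addChr_natCast_mul (n s : ℕ) (k : ℤ) : addChr n (s * k) = addChr n k ^ s := by
  rw [addChr, addChr, ← Complex.exp_nat_mul]; congr 1; push_cast; ring

lemma addChr_two_natCast (s : ℕ) : addChr 2 s = (-1) ^ s := by
  have h : addChr 2 1 = -1 := by
    rw [addChr, ← Complex.exp_pi_mul_I]; congr 1; push_cast; ring
  rw [← h, ← addChr_natCast_mul, mul_one]

lemma norm_addChr (n : ℕ) (k : ℤ) : ‖addChr n k‖ = 1 := by
  have : (2 * Real.pi * Complex.I * k / n : ℂ) = ((2 * Real.pi * k / n : ℝ) : ℂ) * Complex.I := by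
    push_cast; ring
  rw [addChr, this, Complex.norm_exp_ofReal_mul_I]

lemma sum_addChr {n : ℕ} (hn : 0 < n) (k : ℤ) :
    ∑ s ∈ Finset.range n, addChr n (s * k) = if (n : ℤ) ∣ k then (n : ℂ) else 0 := by
  simp_rw [addChr_natCast_mul]
  split_ifs with h
  · simp [addChr_of_dvd hn h]
  · rw [geom_sum_eq (mt (addChr_eq_one_iff hn k).mp h), ← addChr_natCast_mul,
      addChr_of_dvd hn (Dvd.intro _ rfl), sub_self, zero_div]

/-- The indicator function of the residue class of `m` modulo `n`. -/
def residueInd (n : ℕ) (m j : ℤ) : ℂ := if (n : ℤ) ∣ j - m then 1 else 0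

/-- The coefficients, as a function on `ℤ × ℤ`, of the expansion of `cosetTheta` as a double theta
series: a signed indicator function, with signs `addChr 2 s = (-1) ^ s`. -/
def thetaCoeff (u v w : ℕ) (μ r a b : ℤ) : ℂ :=
  ∑ s ∈ Finset.range (2 * v), addChr 2 s * residueInd (2 * (u * v)) (v * r - u * s) a
    * residueInd (2 * (w * v)) (v * μ - w * s) b

lemma sum_if_dvd_add {u v : ℕ} (hv : 0 < v) (huv : Nat.Coprime u v) (a : ℤ) :
    ∑ s ∈ Finset.range (2 * v), (if (v : ℤ) ∣ a + u * s then (1 : ℂ) else 0) = 2 := by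
  have hper : Function.Periodic (fun s : ℤ => if (v : ℤ) ∣ a + u * s then (1 : ℂ) else 0) v := by
    intro s
    have : a + u * (s + v) = a + u * s + v * u := by ring
    simp only [this, Int.dvd_add_left (Dvd.intro _ rfl : (v : ℤ) ∣ v * u)]
  have h1 : ∑ s ∈ Finset.range v, (if (v : ℤ) ∣ a + u * s then (1 : ℂ) else 0) = 1 := by
    obtain ⟨x, y, hxy⟩ : IsCoprime (u : ℤ) v := Nat.isCoprime_iff_coprime.mpr huv
    refine (Finset.sum_congr rfl fun s _ => ?_).trans
      (sum_range_dvd_sub hv (F := fun _ => 1) (fun _ => rfl) (-(a * x)))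
    refine if_congr ⟨fun ⟨c, hc⟩ => ⟨-(x * c + y * s), ?_⟩,
      fun ⟨c, hc⟩ => ⟨-(u * c) + a * y, ?_⟩⟩ rfl rfl
    · linear_combination (-x) * hc + (s : ℤ) * hxy
    · linear_combination (-(u : ℤ)) * hc - a * hxy
  rw [sum_range_two_mul hper, h1, mul_one]

lemma sum_residueInd_mul {u v : ℕ} (hu : 0 < u) (hv : 0 < v) {F : ℤ → ℂ}
    (hF : Function.Periodic F (2 * u : ℕ)) (x₀ c : ℤ) :
    ∑ x ∈ Finset.range (2 * u), F x * residueInd (2 * (u * v)) (v * x - c) (v * x₀ - c) = F x₀ := by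
  rw [← sum_range_dvd_sub (by omega : 0 < 2 * u) hF x₀]
  refine Finset.sum_congr rfl fun x _ => ?_
  have : ((2 * (u * v) : ℕ) : ℤ) ∣ v * x₀ - c - (v * x - c) ↔ ((2 * u : ℕ) : ℤ) ∣ x₀ - x := by
    have h1 : ((2 * (u * v) : ℕ) : ℤ) = v * (2 * u : ℕ) := by push_cast; ring
    have h2 : v * x₀ - c - (v * x - c) = (v : ℤ) * (x₀ - x) := by ring
    rw [h1, h2, mul_dvd_mul_iff_left (by exact_mod_cast hv.ne')]
  simp only [residueInd, this, mul_ite, mul_one, mul_zero]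

lemma residueInd_eq_zero {u v : ℕ} {a c : ℤ} (h : ¬ (v : ℤ) ∣ a + c) (x : ℤ) :
    residueInd (2 * (u * v)) (v * x - c) a = 0 := by
  rw [residueInd, if_neg]
  rintro ⟨d, hd⟩
  refine h ⟨x + 2 * u * d, ?_⟩
  push_cast at hd
  linear_combination hd

/-- Completeness of the cosets: the characters of `ℤ × ℤ` supported on `a + b ≡ v` modulo `2 v`
are combinations of the coefficient functions `thetaCoeff`. -/
lemma sum_thetaCoeff {u v w : ℕ} (hu : 0 < u) (hv : 0 < v) (hw : 0 < w) (huv : Nat.Coprime u v)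
    (huw : u + w = 2 * v) {μ r : ℤ} (hμ : Odd (μ + r)) (a b : ℤ) :
    ∑ r' ∈ Finset.range (2 * u), ∑ μ' ∈ Finset.range (2 * w),
      (if Odd ((μ' : ℤ) + r') then
        addChr (2 * u) (-(r * (v * r'))) * addChr (2 * w) (-(μ * (v * μ')))
        * thetaCoeff u v w μ' r' a b else 0)
    = if ((2 * v : ℕ) : ℤ) ∣ a + b + v then
        2 * (addChr (2 * u) (-(r * a)) * addChr (2 * w) (-(μ * b))) else 0 := by
  set E : ℂ := addChr (2 * u) (-(r * a)) * addChr (2 * w) (-(μ * b)) with hE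
  -- the contribution of a fixed `s`
  have key : ∀ s : ℤ, ∑ r' ∈ Finset.range (2 * u), ∑ μ' ∈ Finset.range (2 * w),
      (if Odd ((μ' : ℤ) + r') then
        addChr (2 * u) (-(r * (v * r'))) * addChr (2 * w) (-(μ * (v * μ')))
        * (addChr 2 s * residueInd (2 * (u * v)) (v * r' - u * s) a
          * residueInd (2 * (w * v)) (v * μ' - w * s) b) else 0)
      = if ((2 * v : ℕ) : ℤ) ∣ a + b + v then
          E * (if (v : ℤ) ∣ a + u * s then 1 else 0) else 0 := by
    intro s
    by_cases ha : (v : ℤ) ∣ a + u * s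
    swap
    · simp [residueInd_eq_zero ha, ha]
    by_cases hb : (v : ℤ) ∣ b + w * s
    swap
    · rw [if_neg]
      · simp [residueInd_eq_zero hb]
      · intro h
        apply hb
        have h1 : (v : ℤ) ∣ a + b + v := dvd_trans ⟨2, by push_cast; ring⟩ h
        have h2 : b + w * s = (a + b + v) - (a + u * s) + v * (2 * s - 1) := by
          have : (u : ℤ) + w = 2 * v := by exact_mod_cast huw
          linear_combination s * this
        rw [h2]
        exact dvd_add (dvd_sub h1 ha) (Dvd.intro _ rfl)
    obtain ⟨r₀, hr₀⟩ := ha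
    obtain ⟨μ₀, hμ₀⟩ := hb
    have ha' : a = v * r₀ - u * s := by linarith
    have hb' : b = v * μ₀ - w * s := by linarith
    have hinner : ∀ r' : ℤ, ∑ μ' ∈ Finset.range (2 * w),
        (if Odd ((μ' : ℤ) + r') then
        addChr (2 * u) (-(r * (v * r'))) * addChr (2 * w) (-(μ * (v * μ')))
        * (addChr 2 s * residueInd (2 * (u * v)) (v * r' - u * s) a
          * residueInd (2 * (w * v)) (v * μ' - w * s) b) else 0)
        = (if Odd (μ₀ + r') then addChr (2 * u) (-(r * (v * r')))
          * addChr (2 * w) (-(μ * (v * μ₀))) * addChr 2 s else 0)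
          * residueInd (2 * (u * v)) (v * r' - u * s) a := by
      intro r'
      have := sum_residueInd_mul hw hv (F := fun μ' => if Odd (μ' + r') then
        addChr (2 * u) (-(r * (v * r'))) * addChr (2 * w) (-(μ * (v * μ'))) * addChr 2 s else 0)
        (by
          intro x
          have h1 : addChr (2 * w) (-(μ * (v * (x + (2 * w : ℕ)))))
              = addChr (2 * w) (-(μ * (v * x))) :=
            addChr_congr (by omega) ⟨-(μ * v), by push_cast; ring⟩
          have h2 : Odd (x + ((2 * w : ℕ) : ℤ) + r') ↔ Odd (x + r') := by
            push_cast; grind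
          simp only [h1, h2]) μ₀ (w * s)
      rw [← hb'] at this
      rw [← this, Finset.sum_mul]
      refine Finset.sum_congr rfl fun x _ => ?_
      split_ifs <;> ring
    have houter := sum_residueInd_mul hu hv (F := fun r' => if Odd (μ₀ + r') then
        addChr (2 * u) (-(r * (v * r'))) * addChr (2 * w) (-(μ * (v * μ₀))) * addChr 2 s else 0)
        (by
          intro x
          have h1 : addChr (2 * u) (-(r * (v * (x + (2 * u : ℕ)))))
              = addChr (2 * u) (-(r * (v * x))) :=
            addChr_congr (by omega) ⟨-(r * v), by push_cast; ring⟩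
          have h2 : Odd (μ₀ + (x + ((2 * u : ℕ) : ℤ))) ↔ Odd (μ₀ + x) := by
            push_cast; grind
          simp only [h1, h2]) r₀ (u * s)
    rw [← ha'] at houter
    refine ((Finset.sum_congr rfl fun r' _ => hinner _).trans houter).trans ?_
    have hodd : Odd (μ₀ + r₀) ↔ ((2 * v : ℕ) : ℤ) ∣ a + b + v := by
      have huw' : (u : ℤ) + w = 2 * v := by exact_mod_cast huw
      have h1 : a + b + v = v * (μ₀ + r₀ + 1 - 2 * s) := by
        rw [ha', hb']; linear_combination (-s) * huw'
      have h2 : ((2 * v : ℕ) : ℤ) = v * 2 := by push_cast; ring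
      rw [h1, h2, mul_dvd_mul_iff_left (by exact_mod_cast hv.ne'), ← even_iff_two_dvd]
      grind
    simp only [hodd, if_pos (Dvd.intro _ hr₀.symm : (v : ℤ) ∣ a + u * s), mul_one]
    refine if_congr Iff.rfl ?_ rfl
    -- the dependence on `s` cancels because `μ + r` is odd
    have h1 : -(r * (v * r₀)) = -(r * a) + u * (-(r * s)) := by rw [ha']; ring
    have h2 : -(μ * (v * μ₀)) = -(μ * b) + w * (-(μ * s)) := by rw [hb']; ring
    rw [h1, h2, addChr_add, addChr_add, mul_comm 2 u, mul_comm 2 w, addChr_mul_left hu,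
      addChr_mul_left hw, hE, mul_comm 2 u, mul_comm 2 w]
    have h3 : addChr 2 (-(r * s)) * addChr 2 (-(μ * s)) * addChr 2 s = 1 := by
      rw [← addChr_add, ← addChr_add]
      apply addChr_of_dvd two_pos
      obtain ⟨c, hc⟩ := hμ
      exact ⟨-(c * s), by push_cast; linear_combination (-s) * hc⟩
    linear_combination (addChr (u * 2) (-(r * a)) * addChr (w * 2) (-(μ * b))) * h3
  simp only [thetaCoeff, Finset.mul_sum]
  have hswap : ∀ (r' μ' : ℕ), (if Odd ((μ' : ℤ) + r') then ∑ s ∈ Finset.range (2 * v),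
      addChr (2 * u) (-(r * (v * r'))) * addChr (2 * w) (-(μ * (v * μ')))
        * (addChr 2 s * residueInd (2 * (u * v)) (v * r' - u * s) a
          * residueInd (2 * (w * v)) (v * μ' - w * s) b) else 0)
      = ∑ s ∈ Finset.range (2 * v), (if Odd ((μ' : ℤ) + r') then
      addChr (2 * u) (-(r * (v * r'))) * addChr (2 * w) (-(μ * (v * μ')))
        * (addChr 2 s * residueInd (2 * (u * v)) (v * r' - u * s) a
          * residueInd (2 * (w * v)) (v * μ' - w * s) b) else 0) := by
    intro r' μ'
    split_ifs
    · rfl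
    · simp
  simp_rw [hswap]
  rw [Finset.sum_congr rfl fun r' _ => Finset.sum_comm, Finset.sum_comm]
  refine (Finset.sum_congr rfl fun s _ => key _).trans ?_
  split_ifs
  · rw [← Finset.mul_sum, sum_if_dvd_add hv huv, mul_comm]
  · simp

/-- The character sum produced by the inversion of the double theta series. -/
lemma sum_addChr_inversion {u v w : ℕ} (hu : 0 < u) (hv : 0 < v) (hw : 0 < w) (μ r a b : ℤ) :
    ∑ s ∈ Finset.range (2 * v), addChr 2 s * addChr (2 * (u * v)) (-((v * r - u * s) * a))
      * addChr (2 * (w * v)) (-((v * μ - w * s) * b))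
    = if ((2 * v : ℕ) : ℤ) ∣ a + b + v then
        (2 * v : ℕ) * (addChr (2 * u) (-(r * a)) * addChr (2 * w) (-(μ * b))) else 0 := by
  have h : ∀ s ∈ Finset.range (2 * v),
      addChr 2 s * addChr (2 * (u * v)) (-((v * r - u * s) * a))
      * addChr (2 * (w * v)) (-((v * μ - w * s) * b))
      = addChr (2 * u) (-(r * a)) * addChr (2 * w) (-(μ * b))
        * addChr (2 * v) (s * (a + b + v)) := by
    intro s _
    have h1 : -((v * r - u * s) * a) = v * (-(r * a)) + u * (s * a) := by ring
    have h2 : -((v * μ - w * s) * b) = v * (-(μ * b)) + w * (s * b) := by ring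
    have h3 : (s : ℤ) * (a + b + v) = s * a + s * b + v * s := by ring
    rw [h1, h2, h3, addChr_add, addChr_add, addChr_add, addChr_add]
    rw [show 2 * (u * v) = v * (2 * u) by ring, addChr_mul_left hv,
      show v * (2 * u) = u * (2 * v) by ring, addChr_mul_left hu,
      show 2 * (w * v) = v * (2 * w) by ring, addChr_mul_left hv,
      show v * (2 * w) = w * (2 * v) by ring, addChr_mul_left hw]
    have h4 : addChr (2 * v) (v * s) = addChr 2 s := by
      rw [mul_comm 2 v, addChr_mul_left hv]
    rw [h4]
    ring
  rw [Finset.sum_congr rfl h, ← Finset.mul_sum, sum_addChr (by omega)]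
  split_ifs <;> ring

/-! ### Theta series in one and two variables -/

/-- The Gaussian `q ^ (j ^ 2 / 4 N)`. -/
def gaussTerm (N : ℕ) (j : ℤ) (τ : ℂ) : ℂ :=
  Complex.exp (2 * Real.pi * Complex.I * (j ^ 2 / (4 * N)) * τ)

/-- The theta series `∑ f(j) j ^ k q ^ (j ^ 2 / 4 N)` over all integers `j`. -/
def thetaSeries (N k : ℕ) (f : ℤ → ℂ) (τ : ℂ) : ℂ := ∑' j : ℤ, f j * j ^ k * gaussTerm N j τ

/-- The theta series `∑ φ(a, b) b q ^ (a ^ 2 / 4 M + b ^ 2 / 4 N)` over `ℤ × ℤ`. -/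
def doubleTheta (M N : ℕ) (φ : ℤ → ℤ → ℂ) (τ : ℂ) : ℂ :=
  ∑' p : ℤ × ℤ, φ p.1 p.2 * (gaussTerm M p.1 τ * (p.2 * gaussTerm N p.2 τ))

/-- The modulus of `j ^ k q ^ (j ^ 2 / 4 N)` for `Im τ = T`. -/
def gaussBound (N k : ℕ) (T : ℝ) (j : ℤ) : ℝ :=
  |(j : ℝ)| ^ k * Real.exp (-(2 * Real.pi * (j ^ 2 / (4 * N)) * T))

lemma norm_gaussTerm (N : ℕ) (j : ℤ) (τ : ℂ) :
    ‖gaussTerm N j τ‖ = Real.exp (-(2 * Real.pi * (j ^ 2 / (4 * N)) * τ.im)) := by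
  have : (2 * Real.pi * Complex.I * (j ^ 2 / (4 * N)) * τ : ℂ)
      = ((2 * Real.pi * (j ^ 2 / (4 * N)) : ℝ) : ℂ) * (Complex.I * τ) := by push_cast; ring
  rw [gaussTerm, Complex.norm_exp, this, Complex.re_ofReal_mul, Complex.I_mul_re]
  ring_nf

lemma norm_pow_mul_gaussTerm_le (N k : ℕ) (j : ℤ) {T : ℝ} {τ : ℂ} (hτ : T ≤ τ.im) :
    ‖(j : ℂ) ^ k * gaussTerm N j τ‖ ≤ gaussBound N k T j := by
  rw [norm_mul, norm_pow, norm_gaussTerm, Complex.norm_intCast, gaussBound]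
  gcongr

lemma gaussBound_nonneg (N k : ℕ) (T : ℝ) (j : ℤ) : 0 ≤ gaussBound N k T j := by
  unfold gaussBound; positivity

lemma summable_gaussBound {N : ℕ} (hN : 0 < N) (k : ℕ) {T : ℝ} (hT : 0 < T) :
    Summable (gaussBound N k T) := by
  have hN' : (0 : ℝ) < N := by exact_mod_cast hN
  refine (summable_pow_mul_jacobiTheta₂_term_bound 0 (T := T / (2 * N)) (by positivity) k).congr
    fun j => ?_
  rw [gaussBound]
  congr 1
  · simp
  · congr 1; field_simp; ring

lemma summable_thetaSeries {N : ℕ} (hN : 0 < N) (k : ℕ) {f : ℤ → ℂ} (hf : ∀ j, ‖f j‖ ≤ 1) {τ : ℂ}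
    (hτ : 0 < τ.im) : Summable fun j : ℤ => ‖f j * j ^ k * gaussTerm N j τ‖ := by
  refine Summable.of_nonneg_of_le (fun _ => norm_nonneg _) (fun j => ?_)
    (summable_gaussBound hN k hτ)
  rw [mul_assoc, norm_mul]
  exact (mul_le_of_le_one_left (norm_nonneg _) (hf j)).trans
    (norm_pow_mul_gaussTerm_le N k j le_rfl)

lemma norm_doubleTheta_term_le (M N : ℕ) {φ : ℤ → ℤ → ℂ} {C : ℝ} (hφ : ∀ a b, ‖φ a b‖ ≤ C)
    {T : ℝ} {τ : ℂ} (hτ : T ≤ τ.im) (p : ℤ × ℤ) :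
    ‖φ p.1 p.2 * (gaussTerm M p.1 τ * (p.2 * gaussTerm N p.2 τ))‖
      ≤ C * (gaussBound M 0 T p.1 * gaussBound N 1 T p.2) := by
  have h1 := norm_pow_mul_gaussTerm_le M 0 p.1 hτ
  have h2 := norm_pow_mul_gaussTerm_le N 1 p.2 hτ
  rw [pow_zero, one_mul] at h1
  rw [pow_one] at h2
  rw [norm_mul, norm_mul (gaussTerm _ _ _)]
  have hC : 0 ≤ C := (norm_nonneg _).trans (hφ 0 0)
  have := gaussBound_nonneg M 0 T p.1
  gcongr
  exact hφ _ _

lemma summable_doubleTheta_bound {M N : ℕ} (hM : 0 < M) (hN : 0 < N) (C : ℝ) {T : ℝ}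
    (hT : 0 < T) :
    Summable fun p : ℤ × ℤ => C * (gaussBound M 0 T p.1 * gaussBound N 1 T p.2) :=
  ((summable_gaussBound hM 0 hT).mul_of_nonneg (summable_gaussBound hN 1 hT)
    (gaussBound_nonneg _ _ _) (gaussBound_nonneg _ _ _)).mul_left C

lemma summable_doubleTheta {M N : ℕ} (hM : 0 < M) (hN : 0 < N) {φ : ℤ → ℤ → ℂ} {C : ℝ}
    (hφ : ∀ a b, ‖φ a b‖ ≤ C) {τ : ℂ} (hτ : 0 < τ.im) :
    Summable fun p : ℤ × ℤ => φ p.1 p.2 * (gaussTerm M p.1 τ * (p.2 * gaussTerm N p.2 τ)) :=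
  Summable.of_norm_bounded (summable_doubleTheta_bound hM hN C hτ)
    (norm_doubleTheta_term_le M N hφ le_rfl)

lemma differentiable_gaussTerm (N : ℕ) (j : ℤ) : Differentiable ℂ (gaussTerm N j) := by
  unfold gaussTerm; fun_prop

lemma differentiableAt_doubleTheta {M N : ℕ} (hM : 0 < M) (hN : 0 < N) {φ : ℤ → ℤ → ℂ} {C : ℝ}
    (hφ : ∀ a b, ‖φ a b‖ ≤ C) {τ : ℂ} (hτ : 0 < τ.im) :
    DifferentiableAt ℂ (doubleTheta M N φ) τ := by
  have hopen : IsOpen {z : ℂ | τ.im / 2 < z.im} := isOpen_lt continuous_const Complex.continuous_im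
  have := Complex.differentiableOn_tsum_of_summable_norm
    (F := fun (p : ℤ × ℤ) z => φ p.1 p.2 * (gaussTerm M p.1 z * (p.2 * gaussTerm N p.2 z)))
    (summable_doubleTheta_bound hM hN C (half_pos hτ)) (fun p => by
      have h1 := differentiable_gaussTerm M p.1
      have h2 := differentiable_gaussTerm N p.2
      exact Differentiable.differentiableOn (by fun_prop)) hopen
    (fun p z hz => norm_doubleTheta_term_le M N hφ (le_of_lt hz) p)
  exact this.differentiableAt (hopen.mem_nhds (half_lt_self hτ))

lemma exists_norm_doubleTheta_le {M N : ℕ} (hM : 0 < M) (hN : 0 < N) {φ : ℤ → ℤ → ℂ} {C : ℝ}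
    (hφ : ∀ a b, ‖φ a b‖ ≤ C) : ∃ B : ℝ, ∀ τ : ℂ, 1 ≤ τ.im → ‖doubleTheta M N φ τ‖ ≤ B := by
  refine ⟨_, fun τ hτ => tsum_of_norm_bounded
    (summable_doubleTheta_bound hM hN C one_pos).hasSum (norm_doubleTheta_term_le M N hφ hτ)⟩

lemma thetaSeries_mul_thetaSeries {M N : ℕ} (hM : 0 < M) (hN : 0 < N) {f g : ℤ → ℂ}
    (hf : ∀ j, ‖f j‖ ≤ 1) (hg : ∀ j, ‖g j‖ ≤ 1) {τ : ℂ} (hτ : 0 < τ.im) :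
    thetaSeries M 0 f τ * thetaSeries N 1 g τ = doubleTheta M N (fun a b => f a * g b) τ := by
  rw [thetaSeries, thetaSeries, tsum_mul_tsum_of_summable_norm (summable_thetaSeries hM 0 hf hτ)
    (summable_thetaSeries hN 1 hg hτ), doubleTheta]
  refine tsum_congr fun p => ?_
  ring

lemma doubleTheta_sum {ι : Type*} {M N : ℕ} (hM : 0 < M) (hN : 0 < N) (s : Finset ι)
    (c : ι → ℂ) {φ : ι → ℤ → ℤ → ℂ} {C : ℝ} (hφ : ∀ i a b, ‖φ i a b‖ ≤ C) {τ : ℂ}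
    (hτ : 0 < τ.im) :
    ∑ i ∈ s, c i * doubleTheta M N (φ i) τ
      = doubleTheta M N (fun a b => ∑ i ∈ s, c i * φ i a b) τ := by
  have h := fun i => summable_doubleTheta hM hN (hφ i) hτ
  simp only [doubleTheta, ← tsum_mul_left]
  rw [← Summable.tsum_finsetSum fun i _ => (h i).mul_left (c i)]
  refine tsum_congr fun p => ?_
  rw [Finset.sum_mul]
  exact Finset.sum_congr rfl fun i _ => by ring

lemma norm_residueInd_le (n : ℕ) (m j : ℤ) : ‖residueInd n m j‖ ≤ 1 := by
  unfold residueInd; split_ifs <;> simp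

lemma residueInd_congr {n : ℕ} {m m' : ℤ} (h : (n : ℤ) ∣ m - m') :
    residueInd n m = residueInd n m' := by
  funext j
  have : j - m' = j - m + (m - m') := by ring
  simp only [residueInd, this, dvd_add_left h]

lemma gaussTerm_neg (N : ℕ) (j : ℤ) (τ : ℂ) : gaussTerm N (-j) τ = gaussTerm N j τ := by
  simp [gaussTerm]

lemma thetaSeries_residueInd_neg (N k n : ℕ) (m : ℤ) (τ : ℂ) :
    thetaSeries N k (residueInd n (-m)) τ = (-1) ^ k * thetaSeries N k (residueInd n m) τ := by
  rw [thetaSeries, thetaSeries, ← tsum_mul_left, ← (Equiv.neg ℤ).tsum_eq]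
  refine tsum_congr fun j => ?_
  have : residueInd n (-m) (-j) = residueInd n m j := by
    have h : -j - -m = -(j - m) := by ring
    simp only [residueInd, h, dvd_neg]
  rw [Equiv.neg_apply, this, gaussTerm_neg]
  push_cast
  rw [neg_pow (j : ℂ)]
  ring

lemma thetaSeries_residueInd {N : ℕ} (hN : 0 < N) (k : ℕ) (m : ℤ) (τ : ℂ) :
    thetaSeries N k (residueInd (2 * N) m) τ
      = ∑' n : ℤ, ((m + 2 * N * n : ℤ) : ℂ) ^ k * gaussTerm N (m + 2 * N * n) τ := by
  have hN' : (N : ℤ) ≠ 0 := by exact_mod_cast hN.ne'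
  have hinj : Function.Injective fun n : ℤ => m + 2 * N * n := by
    intro x y h
    simpa [hN.ne'] using h
  rw [thetaSeries, ← hinj.tsum_eq]
  · refine tsum_congr fun n => ?_
    simp [residueInd]
  · intro j hj
    by_contra h
    apply hj
    have : ¬ ((2 * N : ℕ) : ℤ) ∣ j - m := by
      rintro ⟨c, hc⟩
      exact h ⟨c, by push_cast at hc; simp only; linarith⟩
    simp only [residueInd, if_neg this, zero_mul]

lemma gaussTerm_add {N : ℕ} (hN : 0 < N) (m n : ℤ) (τ : ℂ) :
    gaussTerm N (m + 2 * N * n) τ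
      = gaussTerm N m τ * jacobiTheta₂_term n (m * τ) (2 * N * τ) := by
  have hN' : (N : ℂ) ≠ 0 := by exact_mod_cast hN.ne'
  rw [gaussTerm, gaussTerm, jacobiTheta₂_term, ← Complex.exp_add]
  congr 1
  push_cast
  field_simp
  ring

lemma im_two_mul_natCast_mul {N : ℕ} (hN : 0 < N) {τ : ℂ} (hτ : 0 < τ.im) :
    0 < (2 * N * τ).im := by
  have : (2 * N * τ : ℂ) = ((2 * N : ℝ) : ℂ) * τ := by push_cast; ring
  rw [this, Complex.im_ofReal_mul]
  positivity

lemma thetaSeries_zero_residueInd {N : ℕ} (hN : 0 < N) (m : ℤ) (τ : ℂ) :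
    thetaSeries N 0 (residueInd (2 * N) m) τ
      = gaussTerm N m τ * jacobiTheta₂ (m * τ) (2 * N * τ) := by
  simp only [thetaSeries_residueInd hN, pow_zero, one_mul, gaussTerm_add hN, tsum_mul_left,
    jacobiTheta₂]

lemma thetaSeries_one_residueInd {N : ℕ} (hN : 0 < N) (m : ℤ) {τ : ℂ} (hτ : 0 < τ.im) :
    thetaSeries N 1 (residueInd (2 * N) m) τ
      = gaussTerm N m τ * (m * jacobiTheta₂ (m * τ) (2 * N * τ)
        + 2 * N / (2 * Real.pi * Complex.I) * jacobiTheta₂' (m * τ) (2 * N * τ)) := by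
  have hτ' := im_two_mul_natCast_mul hN hτ
  have h1 := hasSum_jacobiTheta₂_term (m * τ) hτ'
  have h2 := hasSum_jacobiTheta₂'_term (m * τ) hτ'
  rw [thetaSeries_residueInd hN]
  have := ((h1.mul_left (m : ℂ)).add
    (h2.mul_left (2 * N / (2 * Real.pi * Complex.I) : ℂ))).mul_left (gaussTerm N m τ)
  rw [← this.tsum_eq]
  refine tsum_congr fun n => ?_
  rw [gaussTerm_add hN, jacobiTheta₂'_term, pow_one]
  have := Complex.two_pi_I_ne_zero
  have : (2 * N / (2 * Real.pi * Complex.I) : ℂ) * (2 * Real.pi * Complex.I * n *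
      jacobiTheta₂_term n (m * τ) (2 * N * τ))
      = 2 * N * n * jacobiTheta₂_term n (m * τ) (2 * N * τ) := by
    field_simp
  rw [this]
  push_cast
  ring

lemma thetaSeries_residueInd_add_one {N : ℕ} (hN : 0 < N) (k : ℕ) (m : ℤ) (τ : ℂ) :
    thetaSeries N k (residueInd (2 * N) m) (τ + 1)
      = addChr (4 * N) (m ^ 2) * thetaSeries N k (residueInd (2 * N) m) τ := by
  have hN' : (N : ℂ) ≠ 0 := by exact_mod_cast hN.ne'
  rw [thetaSeries_residueInd hN, thetaSeries_residueInd hN, ← tsum_mul_left]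
  refine tsum_congr fun n => ?_
  have h1 : gaussTerm N (m + 2 * N * n) (τ + 1)
      = gaussTerm N (m + 2 * N * n) τ * addChr (4 * N) ((m + 2 * N * n) ^ 2) := by
    rw [gaussTerm, gaussTerm, addChr, ← Complex.exp_add]
    congr 1
    push_cast
    ring
  have h2 : addChr (4 * N) ((m + 2 * N * n) ^ 2) = addChr (4 * N) (m ^ 2) :=
    addChr_congr (by omega) ⟨m * n + N * n ^ 2, by push_cast; ring⟩
  rw [h1, h2]
  ring

lemma jacobiTheta₂_term_addChr {N : ℕ} (hN : 0 < N) (m j : ℤ) (τ : ℂ) :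
    jacobiTheta₂_term j (-m / (2 * N)) (τ / (2 * N))
      = addChr (2 * N) (-(m * j)) * gaussTerm N j τ := by
  have hN' : (N : ℂ) ≠ 0 := by exact_mod_cast hN.ne'
  rw [gaussTerm, addChr, jacobiTheta₂_term, ← Complex.exp_add]
  congr 1
  push_cast
  field_simp
  ring

lemma thetaSeries_zero_addChr {N : ℕ} (hN : 0 < N) (m : ℤ) (τ : ℂ) :
    thetaSeries N 0 (fun j => addChr (2 * N) (-(m * j))) τ
      = jacobiTheta₂ (-m / (2 * N)) (τ / (2 * N)) := by
  simp only [jacobiTheta₂, jacobiTheta₂_term_addChr hN, thetaSeries, pow_zero, mul_one]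

lemma thetaSeries_one_addChr {N : ℕ} (hN : 0 < N) (m : ℤ) (τ : ℂ) :
    2 * Real.pi * Complex.I * thetaSeries N 1 (fun j => addChr (2 * N) (-(m * j))) τ
      = jacobiTheta₂' (-m / (2 * N)) (τ / (2 * N)) := by
  simp only [jacobiTheta₂', jacobiTheta₂'_term, jacobiTheta₂_term_addChr hN, thetaSeries, pow_one,
    ← tsum_mul_left]
  exact tsum_congr fun j => by ring

lemma ne_zero_of_im_pos {τ : ℂ} (hτ : 0 < τ.im) : τ ≠ 0 := by
  rintro rfl; simp at hτ

lemma im_neg_one_div_pos {τ : ℂ} (hτ : 0 < τ.im) : 0 < (-1 / τ).im := by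
  rw [neg_div, Complex.neg_im, one_div, Complex.inv_im, neg_div, neg_neg]
  exact div_pos hτ (Complex.normSq_pos.mpr (ne_zero_of_im_pos hτ))

lemma gaussTerm_neg_one_div {N : ℕ} (hN : 0 < N) (m : ℤ) {τ : ℂ} (hτ : 0 < τ.im) :
    Complex.exp (-Real.pi * Complex.I * (-m / (2 * N)) ^ 2 / (τ / (2 * N)))
      = gaussTerm N m (-1 / τ) := by
  have hN' : (N : ℂ) ≠ 0 := by exact_mod_cast hN.ne'
  have := ne_zero_of_im_pos hτ
  rw [gaussTerm]
  congr 1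
  field_simp
  ring

lemma cpow_half_ne_zero {N : ℕ} (hN : 0 < N) {τ : ℂ} (hτ : 0 < τ.im) :
    (-Complex.I * (τ / (2 * N))) ^ (1 / 2 : ℂ) ≠ 0 := by
  have hN' : (N : ℂ) ≠ 0 := by exact_mod_cast hN.ne'
  have := ne_zero_of_im_pos hτ
  have h : -Complex.I * (τ / (2 * N)) ≠ 0 := by
    simp [hN', this]
  rw [Ne, Complex.cpow_eq_zero_iff]
  exact fun hz => h hz.1

/-- Inversion of a rank one theta series, in terms of a series over all integers: the functional
equation of the Jacobi theta function at `(-m / 2 N, τ / 2 N)`. -/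
lemma thetaSeries_zero_inversion {N : ℕ} (hN : 0 < N) (m : ℤ) {τ : ℂ} (hτ : 0 < τ.im) :
    thetaSeries N 0 (residueInd (2 * N) m) (-1 / τ)
      = (-Complex.I * (τ / (2 * N))) ^ (1 / 2 : ℂ)
        * thetaSeries N 0 (fun j => addChr (2 * N) (-(m * j))) τ := by
  have hN' : (N : ℂ) ≠ 0 := by exact_mod_cast hN.ne'
  have hτ0 := ne_zero_of_im_pos hτ
  have hc := cpow_half_ne_zero hN hτ
  rw [thetaSeries_zero_addChr hN, jacobiTheta₂_functional_equation, gaussTerm_neg_one_div hN m hτ,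
    thetaSeries_zero_residueInd hN]
  have h1 : (-m / (2 * N) / (τ / (2 * N)) : ℂ) = m * (-1 / τ) := by field_simp
  have h2 : (-1 / (τ / (2 * N)) : ℂ) = 2 * N * (-1 / τ) := by field_simp
  rw [h1, h2]
  field_simp

/-- The analogue of `thetaSeries_zero_inversion` for the linear weight; the extra factor `τ`
comes from differentiating in the elliptic variable. -/
lemma thetaSeries_one_inversion {N : ℕ} (hN : 0 < N) (m : ℤ) {τ : ℂ} (hτ : 0 < τ.im) :
    thetaSeries N 1 (residueInd (2 * N) m) (-1 / τ)
      = τ * (-Complex.I * (τ / (2 * N))) ^ (1 / 2 : ℂ)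
        * thetaSeries N 1 (fun j => addChr (2 * N) (-(m * j))) τ := by
  have hN' : (N : ℂ) ≠ 0 := by exact_mod_cast hN.ne'
  have hτ0 := ne_zero_of_im_pos hτ
  have hc := cpow_half_ne_zero hN hτ
  have hpi := Complex.two_pi_I_ne_zero
  have key := thetaSeries_one_addChr hN m τ
  rw [jacobiTheta₂'_functional_equation, gaussTerm_neg_one_div hN m hτ] at key
  rw [thetaSeries_one_residueInd hN m (im_neg_one_div_pos hτ)]
  have h1 : (-m / (2 * N) / (τ / (2 * N)) : ℂ) = m * (-1 / τ) := by field_simp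
  have h2 : (-1 / (τ / (2 * N)) : ℂ) = 2 * N * (-1 / τ) := by field_simp
  rw [h1, h2] at key
  rw [← mul_right_inj' hpi]
  have h3 : 2 * Real.pi * Complex.I * (τ * (-Complex.I * (τ / (2 * N))) ^ (1 / 2 : ℂ)
        * thetaSeries N 1 (fun j => addChr (2 * N) (-(m * j))) τ)
      = (τ * (-Complex.I * (τ / (2 * N))) ^ (1 / 2 : ℂ)) * (2 * Real.pi * Complex.I *
        thetaSeries N 1 (fun j => addChr (2 * N) (-(m * j))) τ) := by ring
  rw [h3, key]
  generalize jacobiTheta₂ _ _ = A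
  generalize jacobiTheta₂' _ _ = B
  generalize gaussTerm _ _ _ = g
  generalize (-Complex.I * (τ / (2 * N))) ^ (1 / 2 : ℂ) = x at *
  have hpi' : (Real.pi : ℂ) ≠ 0 := by exact_mod_cast Real.pi_ne_zero
  have hI := Complex.I_ne_zero
  field_simp
  ring

lemma cpow_half_mul_cpow_half {a b : ℝ} (ha : 0 < a) (hb : 0 < b) {z : ℂ} (hz : z ≠ 0) :
    (a * z) ^ (1 / 2 : ℂ) * (b * z) ^ (1 / 2 : ℂ) = √(a * b) * z := by
  have ha' : (a : ℂ) ≠ 0 := by exact_mod_cast ha.ne'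
  have hb' : (b : ℂ) ≠ 0 := by exact_mod_cast hb.ne'
  rw [Complex.cpow_def_of_ne_zero (mul_ne_zero ha' hz), Complex.cpow_def_of_ne_zero
    (mul_ne_zero hb' hz), Complex.log_ofReal_mul ha hz, Complex.log_ofReal_mul hb hz,
    ← Complex.exp_add]
  have h : ((√(a * b) : ℝ) : ℂ) = Complex.exp ((Real.log a + Real.log b) / 2) := by
    rw [Real.sqrt_eq_rpow, Real.rpow_def_of_pos (mul_pos ha hb), Real.log_mul ha.ne' hb.ne']
    push_cast
    congr 1
    ring
  calc _ = Complex.exp ((Real.log a + Real.log b) / 2) * Complex.exp (Complex.log z) := by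
        rw [← Complex.exp_add]; congr 1; ring
    _ = _ := by rw [h, Complex.exp_log hz]

/-! ### The coset theta functions and their inversion -/

/-- The theta function of a coset of the rank two lattice, with signs `addChr 2 s = (-1) ^ s`,
written as a sum of products of rank one theta series of levels `u v` and `w v`; the second factor has the
linear weight. -/
def cosetTheta (u v w : ℕ) (μ r : ℤ) (τ : ℂ) : ℂ :=
  ∑ s ∈ Finset.range (2 * v), addChr 2 s *
    (thetaSeries (u * v) 0 (residueInd (2 * (u * v)) (v * r - u * s)) τ
      * thetaSeries (w * v) 1 (residueInd (2 * (w * v)) (v * μ - w * s)) τ)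

lemma norm_thetaCoeff_le (u v w : ℕ) (μ r a b : ℤ) : ‖thetaCoeff u v w μ r a b‖ ≤ (2 * v : ℕ) := by
  refine (norm_sum_le _ _).trans ((Finset.sum_le_card_nsmul _ _ 1 fun s _ => ?_).trans (by simp))
  rw [norm_mul, norm_mul, norm_addChr, one_mul]
  exact mul_le_one₀ (norm_residueInd_le _ _ _) (norm_nonneg _) (norm_residueInd_le _ _ _)

lemma doubleTheta_const_mul (M N : ℕ) (c : ℂ) (φ : ℤ → ℤ → ℂ) (τ : ℂ) :
    doubleTheta M N (fun a b => c * φ a b) τ = c * doubleTheta M N φ τ := by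
  simp only [doubleTheta, ← tsum_mul_left, mul_assoc]

variable {u v w : ℕ}

lemma cosetTheta_eq_doubleTheta (hu : 0 < u) (hv : 0 < v) (hw : 0 < w) (μ r : ℤ) {τ : ℂ}
    (hτ : 0 < τ.im) :
    cosetTheta u v w μ r τ = doubleTheta (u * v) (w * v) (thetaCoeff u v w μ r) τ := by
  have huv : 0 < u * v := Nat.mul_pos hu hv
  have hwv : 0 < w * v := Nat.mul_pos hw hv
  have hb : ∀ (s : ℕ) (a b : ℤ), ‖residueInd (2 * (u * v)) (v * r - u * s) a
      * residueInd (2 * (w * v)) (v * μ - w * s) b‖ ≤ 1 := fun s a b => by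
    rw [norm_mul]
    exact mul_le_one₀ (norm_residueInd_le _ _ _) (norm_nonneg _) (norm_residueInd_le _ _ _)
  simp only [cosetTheta, thetaSeries_mul_thetaSeries huv hwv (norm_residueInd_le _ _)
    (norm_residueInd_le _ _) hτ]
  rw [doubleTheta_sum huv hwv _ (fun s : ℕ => addChr 2 s) hb hτ]
  congr 1
  funext a b
  exact Finset.sum_congr rfl fun s _ => (mul_assoc _ _ _).symm

lemma periodic_cosetTheta_summand (μ r : ℤ) (τ : ℂ) :
    Function.Periodic (fun s : ℤ => addChr 2 s *
      (thetaSeries (u * v) 0 (residueInd (2 * (u * v)) (v * r - u * s)) τ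
      * thetaSeries (w * v) 1 (residueInd (2 * (w * v)) (v * μ - w * s)) τ)) (2 * v : ℕ) := by
  intro s
  have h1 : addChr 2 (s + (2 * v : ℕ)) = addChr 2 s :=
    addChr_congr two_pos ⟨v, by push_cast; ring⟩
  have h2 : residueInd (2 * (u * v)) (v * r - u * (s + (2 * v : ℕ)))
      = residueInd (2 * (u * v)) (v * r - u * s) :=
    residueInd_congr ⟨-1, by push_cast; ring⟩
  have h3 : residueInd (2 * (w * v)) (v * μ - w * (s + (2 * v : ℕ)))
      = residueInd (2 * (w * v)) (v * μ - w * s) :=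
    residueInd_congr ⟨-1, by push_cast; ring⟩
  simp only [h1, h2, h3]

lemma cosetTheta_add_two_mul_right (μ r : ℤ) (τ : ℂ) :
    cosetTheta u v w μ (r + (2 * u : ℕ)) τ = cosetTheta u v w μ r τ := by
  refine Finset.sum_congr rfl fun s _ => ?_
  have h : residueInd (2 * (u * v)) (v * (r + (2 * u : ℕ)) - u * s)
      = residueInd (2 * (u * v)) (v * r - u * s) :=
    residueInd_congr ⟨1, by push_cast; ring⟩
  rw [h]

lemma cosetTheta_add_two_mul_left (μ r : ℤ) (τ : ℂ) :
    cosetTheta u v w (μ + (2 * w : ℕ)) r τ = cosetTheta u v w μ r τ := by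
  refine Finset.sum_congr rfl fun s _ => ?_
  have h : residueInd (2 * (w * v)) (v * (μ + (2 * w : ℕ)) - w * s)
      = residueInd (2 * (w * v)) (v * μ - w * s) :=
    residueInd_congr ⟨1, by push_cast; ring⟩
  rw [h]

lemma cosetTheta_neg_neg (hv : 0 < v) (μ r : ℤ) (τ : ℂ) :
    cosetTheta u v w (-μ) (-r) τ = -cosetTheta u v w μ r τ := by
  rw [cosetTheta, cosetTheta, ← sum_range_neg (by omega) (periodic_cosetTheta_summand μ r τ),
    ← Finset.sum_neg_distrib]
  refine Finset.sum_congr rfl fun s _ => ?_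
  have h1 : addChr 2 (-(s : ℤ)) = addChr 2 s := addChr_congr two_pos ⟨-s, by push_cast; ring⟩
  have h2 : (v : ℤ) * -r - u * s = -(v * r - u * -s) := by ring
  have h3 : (v : ℤ) * -μ - w * s = -(v * μ - w * -s) := by ring
  rw [h1, h2, h3, thetaSeries_residueInd_neg, thetaSeries_residueInd_neg]
  ring

lemma cosetTheta_add_add (hv : 0 < v) (μ r : ℤ) (τ : ℂ) :
    cosetTheta u v w (μ + w) (r + u) τ = addChr 2 v * cosetTheta u v w μ r τ := by
  rw [cosetTheta, ← sum_range_add (by omega) (periodic_cosetTheta_summand _ _ τ) v,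
    cosetTheta, Finset.mul_sum]
  refine Finset.sum_congr rfl fun s _ => ?_
  have h2 : (v : ℤ) * (r + u) - u * (s + v) = v * r - u * s := by ring
  have h3 : (v : ℤ) * (μ + w) - w * (s + v) = v * μ - w * s := by ring
  rw [h2, h3, addChr_add]
  ring

/-- Inversion of a coset theta function, by comparing the coefficients of two double theta
series. -/
lemma cosetTheta_inversion (hu : 0 < u) (hv : 0 < v) (hw : 0 < w) (huv : Nat.Coprime u v)
    (huw : u + w = 2 * v) {μ r : ℤ} (hμ : Odd (μ + r)) {τ : ℂ} (hτ : 0 < τ.im) :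
    cosetTheta u v w μ r (-1 / τ) = -Complex.I * τ ^ 2 / (2 * √(u * w : ℝ)) *
      ∑ r' ∈ Finset.range (2 * u), ∑ μ' ∈ Finset.range (2 * w),
        (if Odd ((μ' : ℤ) + r') then
          addChr (2 * u) (-(r * (v * r'))) * addChr (2 * w) (-(μ * (v * μ')))
            * cosetTheta u v w μ' r' τ else 0) := by
  have hM : 0 < u * v := Nat.mul_pos hu hv
  have hN : 0 < w * v := Nat.mul_pos hw hv
  have hu' : (0 : ℝ) < u := by exact_mod_cast hu
  have hv' : (0 : ℝ) < v := by exact_mod_cast hv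
  have hw' : (0 : ℝ) < w := by exact_mod_cast hw
  -- the automorphy factors of the two rank one theta series
  have hfac : (-Complex.I * (τ / (2 * (u * v : ℕ)))) ^ (1 / 2 : ℂ)
      * (-Complex.I * (τ / (2 * (w * v : ℕ)))) ^ (1 / 2 : ℂ)
      = -Complex.I * τ / (2 * v * √(u * w : ℝ)) := by
    have h1 : ∀ x : ℝ, -Complex.I * (τ / x) = ((1 / x : ℝ) : ℂ) * (-Complex.I * τ) := by
      intro x; push_cast; ring
    have h2 := h1 (2 * (u * v : ℕ))
    have h3 := h1 (2 * (w * v : ℕ))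
    push_cast at h2 h3
    push_cast
    rw [h2, h3]
    have h4 := cpow_half_mul_cpow_half (a := 1 / (2 * (u * v))) (b := 1 / (2 * (w * v)))
      (by positivity) (by positivity) (z := -Complex.I * τ)
      (mul_ne_zero (neg_ne_zero.mpr Complex.I_ne_zero) (ne_zero_of_im_pos hτ))
    push_cast at h4
    rw [h4]
    have h5 : √(1 / (2 * (u * v)) * (1 / (2 * (w * v))) : ℝ) = 1 / (2 * v * √(u * w : ℝ)) := by
      rw [Real.sqrt_eq_iff_eq_sq (by positivity) (by positivity), div_pow, mul_pow,
        Real.sq_sqrt (by positivity)]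
      field_simp
    rw [h5]
    push_cast
    ring
  have hb : ∀ (s : ℕ) (a b : ℤ), ‖addChr (2 * (u * v)) (-((v * r - u * s) * a))
      * addChr (2 * (w * v)) (-((v * μ - w * s) * b))‖ ≤ 1 := fun s a b => by
    rw [norm_mul, norm_addChr, norm_addChr, one_mul]
  have hL : cosetTheta u v w μ r (-1 / τ) = τ * (-Complex.I * τ / (2 * v * √(u * w : ℝ))) *
      doubleTheta (u * v) (w * v) (fun a b => ∑ s ∈ Finset.range (2 * v), addChr 2 s *
        (addChr (2 * (u * v)) (-((v * r - u * s) * a))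
        * addChr (2 * (w * v)) (-((v * μ - w * s) * b)))) τ := by
    rw [← doubleTheta_sum hM hN _ (fun s : ℕ => addChr 2 s) hb hτ, cosetTheta, Finset.mul_sum,
      ← hfac]
    refine Finset.sum_congr rfl fun s _ => ?_
    rw [thetaSeries_zero_inversion hM _ hτ, thetaSeries_one_inversion hN _ hτ,
      ← thetaSeries_mul_thetaSeries hM hN (fun j => (norm_addChr _ _).le)
        (fun j => (norm_addChr _ _).le) hτ]
    ring
  have hR : ∑ r' ∈ Finset.range (2 * u), ∑ μ' ∈ Finset.range (2 * w),
        (if Odd ((μ' : ℤ) + r') then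
          addChr (2 * u) (-(r * (v * r'))) * addChr (2 * w) (-(μ * (v * μ')))
            * cosetTheta u v w μ' r' τ else 0)
      = doubleTheta (u * v) (w * v) (fun a b => if ((2 * v : ℕ) : ℤ) ∣ a + b + v then
        2 * (addChr (2 * u) (-(r * a)) * addChr (2 * w) (-(μ * b))) else 0) τ := by
    have h := doubleTheta_sum hM hN (Finset.range (2 * u) ×ˢ Finset.range (2 * w))
      (fun p => if Odd ((p.2 : ℤ) + p.1) then
          addChr (2 * u) (-(r * (v * p.1))) * addChr (2 * w) (-(μ * (v * p.2))) else 0)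
      (φ := fun p => thetaCoeff u v w p.2 p.1)
      (fun p => norm_thetaCoeff_le u v w p.2 p.1) hτ
    simp only [Finset.sum_product, ite_mul, zero_mul, sum_thetaCoeff hu hv hw huv huw hμ] at h
    rw [← h]
    simp only [cosetTheta_eq_doubleTheta hu hv hw _ _ hτ]
  rw [hL, hR]
  have hv0 : (v : ℂ) ≠ 0 := by exact_mod_cast hv.ne'
  have hfun : (fun a b : ℤ => ∑ s ∈ Finset.range (2 * v), addChr 2 s *
        (addChr (2 * (u * v)) (-((v * r - u * s) * a))
        * addChr (2 * (w * v)) (-((v * μ - w * s) * b))))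
      = fun a b => (v : ℂ) * (if ((2 * v : ℕ) : ℤ) ∣ a + b + v then
        2 * (addChr (2 * u) (-(r * a)) * addChr (2 * w) (-(μ * b))) else 0) := by
    funext a b
    have := sum_addChr_inversion hu hv hw μ r a b
    simp only [mul_assoc] at this ⊢
    rw [this]
    split_ifs
    · push_cast; ring
    · simp
  rw [hfun, doubleTheta_const_mul]
  field_simp

/-- The combination of coset theta functions that is even in `μ` and odd in `r`. -/
def oddTheta (u v w : ℕ) (μ r : ℤ) (τ : ℂ) : ℂ :=
  cosetTheta u v w μ r τ - cosetTheta u v w μ (-r) τ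

lemma oddTheta_neg_right (μ r : ℤ) (τ : ℂ) : oddTheta u v w μ (-r) τ = -oddTheta u v w μ r τ := by
  simp [oddTheta]

lemma oddTheta_neg_left (hv : 0 < v) (μ r : ℤ) (τ : ℂ) :
    oddTheta u v w (-μ) r τ = oddTheta u v w μ r τ := by
  have h1 := cosetTheta_neg_neg (u := u) (w := w) hv μ (-r) τ
  have h2 := cosetTheta_neg_neg (u := u) (w := w) hv μ r τ
  rw [neg_neg] at h1
  rw [oddTheta, oddTheta, h1, h2]
  ring

lemma oddTheta_add_two_mul_right (μ r : ℤ) (τ : ℂ) :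
    oddTheta u v w μ (r + (2 * u : ℕ)) τ = oddTheta u v w μ r τ := by
  have h := cosetTheta_add_two_mul_right (u := u) (v := v) (w := w) μ (-(r + (2 * u : ℕ))) τ
  rw [oddTheta, cosetTheta_add_two_mul_right, ← h, oddTheta]
  congr 3
  ring

lemma oddTheta_add_two_mul_left (μ r : ℤ) (τ : ℂ) :
    oddTheta u v w (μ + (2 * w : ℕ)) r τ = oddTheta u v w μ r τ := by
  simp only [oddTheta, cosetTheta_add_two_mul_left]

lemma oddTheta_add_add (hv : 0 < v) (μ r : ℤ) (τ : ℂ) :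
    oddTheta u v w (μ + w) (r + u) τ = addChr 2 v * oddTheta u v w μ r τ := by
  have h1 := cosetTheta_add_add (u := u) (w := w) hv μ r τ
  have h2 := cosetTheta_add_add (u := u) (w := w) hv μ (-r) τ
  have h3 := cosetTheta_add_two_mul_right (u := u) (v := v) (w := w) (μ + w) (-(r + u)) τ
  rw [show -(r + u) + ((2 * u : ℕ) : ℤ) = -r + u by push_cast; ring, h2] at h3
  rw [oddTheta, h1, ← h3, oddTheta]
  ring

lemma addChr_neg_sub_addChr (n : ℕ) (k : ℤ) :
    addChr (2 * n) (-k) - addChr (2 * n) k = -2 * Complex.I * Real.sin (Real.pi * k / n) := by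
  have h1 : addChr (2 * n) (-k) = Complex.exp (-((Real.pi * k / n : ℝ) : ℂ) * Complex.I) := by
    rw [addChr]; congr 1; push_cast; field
  have h2 : addChr (2 * n) k = Complex.exp (((Real.pi * k / n : ℝ) : ℂ) * Complex.I) := by
    rw [addChr]; congr 1; push_cast; field
  rw [h1, h2, Complex.ofReal_sin, Complex.sin]
  ring_nf
  simp
  ring

lemma addChr_neg_add_addChr (n : ℕ) (k : ℤ) :
    addChr (2 * n) (-k) + addChr (2 * n) k = 2 * Real.cos (Real.pi * k / n) := by
  have h1 : addChr (2 * n) (-k) = Complex.exp (-((Real.pi * k / n : ℝ) : ℂ) * Complex.I) := by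
    rw [addChr]; congr 1; push_cast; field
  have h2 : addChr (2 * n) k = Complex.exp (((Real.pi * k / n : ℝ) : ℂ) * Complex.I) := by
    rw [addChr]; congr 1; push_cast; field
  rw [h1, h2, Complex.ofReal_cos, Complex.cos]
  ring

lemma sum_range_sum_range_neg {m n : ℕ} (hm : 0 < m) {f : ℤ → ℤ → ℂ}
    (hf : ∀ y, Function.Periodic (fun x => f x y) m) :
    ∑ x ∈ Finset.range m, ∑ y ∈ Finset.range n, f (-x) y
      = ∑ x ∈ Finset.range m, ∑ y ∈ Finset.range n, f x y :=
  sum_range_neg hm (f := fun x => ∑ y ∈ Finset.range n, f x y)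
    fun x => Finset.sum_congr rfl fun y _ => hf y x

lemma sum_range_sum_range_neg' {m n : ℕ} (hn : 0 < n) {f : ℤ → ℤ → ℂ}
    (hf : ∀ x, Function.Periodic (f x) n) :
    ∑ x ∈ Finset.range m, ∑ y ∈ Finset.range n, f x (-y)
      = ∑ x ∈ Finset.range m, ∑ y ∈ Finset.range n, f x y :=
  Finset.sum_congr rfl fun x _ => sum_range_neg hn (hf x)

/-- The summand of the inversion formula for `oddTheta`. -/
def sKernel (u v w : ℕ) (μ r : ℤ) (τ : ℂ) (r' μ' : ℤ) : ℂ :=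
  if Odd (μ' + r') then (Real.sin (Real.pi * (r * (v * r') : ℤ) / u) : ℂ)
    * Real.cos (Real.pi * (μ * (v * μ') : ℤ) / w) * oddTheta u v w μ' r' τ else 0

lemma oddTheta_inversion (hu : 0 < u) (hv : 0 < v) (hw : 0 < w) (huv : Nat.Coprime u v)
    (huw : u + w = 2 * v) {μ r : ℤ} (hμ : Odd (μ + r)) {τ : ℂ} (hτ : 0 < τ.im) :
    oddTheta u v w μ r (-1 / τ) = -(τ ^ 2) / (2 * √(u * w : ℝ)) *
      ∑ r' ∈ Finset.range (2 * u), ∑ μ' ∈ Finset.range (2 * w), sKernel u v w μ r τ r' μ' := by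
  have hμ' : Odd (μ + -r) := by
    obtain ⟨c, hc⟩ := hμ; exact ⟨c - r, by linarith⟩
  have hu2 : 0 < 2 * u := by omega
  have hw2 : 0 < 2 * w := by omega
  have hper_u : ∀ r x : ℤ, addChr (2 * u) (r * (v * (x + (2 * u : ℕ))))
      = addChr (2 * u) (r * (v * x)) :=
    fun r x => addChr_congr hu2 ⟨r * v, by push_cast; ring⟩
  have hper_w : ∀ r x : ℤ, addChr (2 * w) (r * (v * (x + (2 * w : ℕ))))
      = addChr (2 * w) (r * (v * x)) :=
    fun r x => addChr_congr hw2 ⟨r * v, by push_cast; ring⟩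
  have hoddu : ∀ y x : ℤ, Odd (y + (x + (2 * u : ℕ))) ↔ Odd (y + x) := by
    intro y x; push_cast; grind
  have hoddw : ∀ y x : ℤ, Odd (x + (2 * w : ℕ) + y) ↔ Odd (x + y) := by
    intro y x; push_cast; grind
  have hoddn : ∀ y x : ℤ, Odd (y + -x) ↔ Odd (y + x) := by
    intro y x; grind
  have hoddn' : ∀ y x : ℤ, Odd (-y + x) ↔ Odd (y + x) := by
    intro y x; grind
  let T : ℤ → ℤ → ℂ := fun r' μ' => if Odd (μ' + r') then
    addChr (2 * u) (r * (v * r')) * addChr (2 * w) (-μ * (v * μ')) * cosetTheta u v w μ' r' τ else 0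
  let K : ℤ → ℤ → ℂ := fun r' μ' => if Odd (μ' + r') then
    addChr (2 * u) (-r * (v * r')) * addChr (2 * w) (-μ * (v * μ')) * oddTheta u v w μ' r' τ else 0
  have hT : ∀ y, Function.Periodic (fun x => T x y) (2 * u : ℕ) := by
    intro y x
    simp only [T, hper_u, hoddu, cosetTheta_add_two_mul_right]
  have hK : ∀ y, Function.Periodic (fun x => K x y) (2 * u : ℕ) := by
    intro y x
    simp only [K, hper_u, hoddu, oddTheta_add_two_mul_right]
  have hK' : ∀ x, Function.Periodic (K x) (2 * w : ℕ) := by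
    intro y x
    simp only [K, hper_w, hoddw, oddTheta_add_two_mul_left]
  have h1 : oddTheta u v w μ r (-1 / τ) = -Complex.I * τ ^ 2 / (2 * √(u * w : ℝ)) *
      ∑ r' ∈ Finset.range (2 * u), ∑ μ' ∈ Finset.range (2 * w), K r' μ' := by
    have e1 := cosetTheta_inversion hu hv hw huv huw hμ hτ
    have e2 := cosetTheta_inversion hu hv hw huv huw hμ' hτ
    have e3 : ∑ r' ∈ Finset.range (2 * u), ∑ μ' ∈ Finset.range (2 * w),
        (if Odd ((μ' : ℤ) + r') then
          addChr (2 * u) (-(-r * (v * r'))) * addChr (2 * w) (-(μ * (v * μ')))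
            * cosetTheta u v w μ' r' τ else 0)
        = ∑ r' ∈ Finset.range (2 * u), ∑ μ' ∈ Finset.range (2 * w), T (-r') μ' := by
      rw [sum_range_sum_range_neg hu2 hT]
      simp only [T, neg_mul, neg_neg]
    rw [e3] at e2
    rw [oddTheta, e1, e2, ← mul_sub, ← Finset.sum_sub_distrib]
    congr 1
    refine Finset.sum_congr rfl fun r' _ => ?_
    rw [← Finset.sum_sub_distrib]
    refine Finset.sum_congr rfl fun μ' _ => ?_
    simp only [T, K, hoddn, oddTheta]
    split_ifs
    · simp only [mul_neg, neg_mul]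
      ring
    · simp
  -- symmetrise in `r'` and in `μ'`
  have hK2 : ∀ x, Function.Periodic (fun y => K x y + K (-x) y) (2 * w : ℕ) := fun x y => by
    have e1 := hK' x y
    have e2 := hK' (-x) y
    simp only [e1, e2]
  have h2 : 4 * ∑ r' ∈ Finset.range (2 * u), ∑ μ' ∈ Finset.range (2 * w), K r' μ'
      = ∑ r' ∈ Finset.range (2 * u), ∑ μ' ∈ Finset.range (2 * w),
        ((K r' μ' + K (-r') μ') + (K r' (-μ') + K (-r') (-μ'))) := by
    simp only [Finset.sum_add_distrib]
    rw [sum_range_sum_range_neg' hw2 hK', sum_range_sum_range_neg hu2 hK,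
      sum_range_sum_range_neg hu2 (f := fun x y => K x (-y)) (fun y => hK (-y)),
      sum_range_sum_range_neg' hw2 hK']
    ring
  have h3 : ∀ r' μ' : ℤ, (K r' μ' + K (-r') μ') + (K r' (-μ') + K (-r') (-μ'))
      = -4 * Complex.I * sKernel u v w μ r τ r' μ' := by
    intro r' μ'
    simp only [K, sKernel, hoddn, hoddn', oddTheta_neg_right, oddTheta_neg_left hv]
    split_ifs
    · have e1 := addChr_neg_sub_addChr u (r * (v * r'))
      have e2 := addChr_neg_add_addChr w (μ * (v * μ'))
      simp only [mul_neg, neg_mul, neg_neg]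
      calc _ = (addChr (2 * u) (-(r * (v * r'))) - addChr (2 * u) (r * (v * r')))
            * (addChr (2 * w) (-(μ * (v * μ'))) + addChr (2 * w) (μ * (v * μ')))
            * oddTheta u v w μ' r' τ := by ring
        _ = _ := by rw [e1, e2]; ring
    · simp
  simp only [h3, ← Finset.mul_sum] at h2
  have h4 : ∑ r' ∈ Finset.range (2 * u), ∑ μ' ∈ Finset.range (2 * w), K r' μ'
      = -Complex.I * ∑ r' ∈ Finset.range (2 * u), ∑ μ' ∈ Finset.range (2 * w),
        sKernel u v w μ r τ r' μ' := by
    linear_combination h2 / 4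
  rw [h1, h4]
  linear_combination (τ ^ 2 / (2 * √(u * w : ℝ)) * ∑ r' ∈ Finset.range (2 * u),
    ∑ μ' ∈ Finset.range (2 * w), sKernel u v w μ r τ r' μ') * Complex.I_sq

/-! ### Folding the sum over the box onto the index set -/

/-- A sum over a period box of a function with the symmetries of the summand of the inversion
formula, folded onto the fundamental domain `indexSet u v`; the factor `multA` records the
stabilizers. -/
lemma sum_box_eq_sum_indexSet (hu : 0 < u) (hw : 0 < w) (hwv : wParam u v = w)
    {W : ℤ → ℤ → ℂ}
    (hr : ∀ r μ, W (r + (2 * u : ℕ)) μ = W r μ) (hm : ∀ r μ, W r (μ + (2 * w : ℕ)) = W r μ)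
    (her : ∀ r μ, W (-r) μ = W r μ) (hem : ∀ r μ, W r (-μ) = W r μ)
    (hs : ∀ r μ, W (r + u) (μ + w) = W r μ) (h0 : ∀ μ, W 0 μ = 0)
    (hodd : ∀ r μ, ¬ Odd (μ + r) → W r μ = 0) :
    ∑ r ∈ Finset.range (2 * u), ∑ μ ∈ Finset.range (2 * w), W r μ
      = 4 * ∑ p ∈ indexSet u v, (multA u v p.1 p.2 : ℂ) * W p.2 p.1 := by
  have hw' : (0 : ℤ) < w := by exact_mod_cast hw
  -- fold `r`
  have hWu : ∀ μ, W u μ = 0 := fun μ => by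
    have := hs 0 (μ - w)
    rw [zero_add, sub_add_cancel, h0] at this
    exact this
  have h1 : ∑ r ∈ Finset.range (2 * u), ∑ μ ∈ Finset.range (2 * w), W r μ
      = 2 * ∑ r ∈ Finset.Icc 1 (u - 1), ∑ μ ∈ Finset.range (2 * w), W r μ := by
    rw [sum_range_two_mul_of_even hu (f := fun r => ∑ μ ∈ Finset.range (2 * w), W r μ)
      (fun r => Finset.sum_congr rfl fun μ _ => hr r μ)
      (fun r => Finset.sum_congr rfl fun μ _ => her r μ)]
    simp [h0, hWu]
  -- fold `μ`
  let a : ℤ → ℂ := fun μ => if (w : ℤ) ∣ μ then 1 else 2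
  have h2 : ∀ r : ℤ, ∑ μ ∈ Finset.range (2 * w), W r μ
      = ∑ μ ∈ Finset.Icc (0 : ℤ) w, a μ * W r μ := by
    intro r
    rw [sum_range_two_mul_of_even hw (hm r) (hem r)]
    have e1 : Finset.Icc (0 : ℤ) w = insert 0 (insert (w : ℤ) (Finset.Icc (1 : ℤ) (w - 1))) := by
      ext x; simp only [Finset.mem_Icc, Finset.mem_insert]; omega
    rw [e1, Finset.sum_insert (by simp; omega), Finset.sum_insert (by simp), Finset.mul_sum,
      ← add_assoc]
    congr 1
    · simp [a]
    · refine Finset.sum_bij (fun x _ => (x : ℤ)) ?_ ?_ ?_ ?_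
      · intro x hx; simp only [Finset.mem_Icc] at hx ⊢; omega
      · intro x _ y _ h; exact_mod_cast h
      · intro x hx
        simp only [Finset.mem_Icc] at hx
        exact ⟨x.toNat, by simp only [Finset.mem_Icc]; omega, by omega⟩
      · intro x hx
        simp only [Finset.mem_Icc] at hx
        have : ¬ (w : ℤ) ∣ x := fun h => by
          have := Int.le_of_dvd (by omega) h
          omega
        simp [a, this]
  let X := Finset.Icc (0 : ℤ) w ×ˢ Finset.Icc 1 (u - 1)
  let h : ℤ × ℕ → ℂ := fun p => a p.1 * W p.2 p.1
  have h3 : ∑ r ∈ Finset.range (2 * u), ∑ μ ∈ Finset.range (2 * w), W r μ = 2 * ∑ p ∈ X, h p := by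
    rw [h1]
    simp only [h2, X, h, Finset.sum_product_right]
  -- the involution `(μ; r) ↦ (w - μ; u - r)`
  let σ : ℤ × ℕ → ℤ × ℕ := fun p => (w - p.1, u - p.2)
  have hX : ∀ p ∈ X, σ p ∈ X := by
    rintro ⟨μ, r⟩ hp
    simp only [X, σ, Finset.mem_product, Finset.mem_Icc] at hp ⊢
    omega
  have hσσ : ∀ p ∈ X, σ (σ p) = p := by
    rintro ⟨μ, r⟩ hp
    simp only [X, σ, Finset.mem_product, Finset.mem_Icc, Prod.mk.injEq] at hp ⊢
    omega
  have hhσ : ∀ p ∈ X, h (σ p) = h p := by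
    rintro ⟨μ, r⟩ hp
    simp only [X, Finset.mem_product, Finset.mem_Icc] at hp
    have e1 : ((u - r : ℕ) : ℤ) = -(r : ℤ) + u := by omega
    have e2 : (w : ℤ) - μ = -μ + w := by ring
    have e3 : (w : ℤ) ∣ -μ + w ↔ (w : ℤ) ∣ μ := by simp
    simp only [h, σ, a, e1, e2, hs, her, hem, e3]
  -- weights of a fundamental domain of the involution
  let κ : ℤ × ℕ → ℂ := fun p => if 2 * p.2 < u then 2 else if 2 * p.2 = u then
    (if 2 * p.1 < w then 2 else if 2 * p.1 = w then 1 else 0) else 0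
  have hκ : ∀ p ∈ X, κ p + κ (σ p) = 2 := by
    rintro ⟨μ, r⟩ hp
    simp only [X, Finset.mem_product, Finset.mem_Icc] at hp
    simp only [κ, σ]
    split_ifs <;> first | omega | norm_num
  have h4 : ∑ p ∈ X, h p = ∑ p ∈ X, κ p * h p := by
    have e : ∑ p ∈ X, κ p * h p = ∑ p ∈ X, κ (σ p) * h p := by
      refine Finset.sum_nbij' σ σ hX hX hσσ hσσ fun p hp => ?_
      rw [hσσ p hp, hhσ p hp]
    have e2 : ∑ p ∈ X, κ p * h p + ∑ p ∈ X, κ (σ p) * h p = 2 * ∑ p ∈ X, h p := by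
      rw [← Finset.sum_add_distrib, Finset.mul_sum]
      exact Finset.sum_congr rfl fun p hp => by rw [← add_mul, hκ p hp]
    rw [← e] at e2
    linear_combination -e2 / 2
  rw [h3, h4, indexSet, hwv, Finset.sum_filter, Finset.mul_sum, Finset.mul_sum]
  refine Finset.sum_congr rfl ?_
  rintro ⟨μ, r⟩ hp
  simp only [Finset.mem_product, Finset.mem_Icc] at hp
  by_cases hpar : Odd (μ + r)
  swap
  · simp only [h, hodd r μ hpar, mul_zero, ite_self]
  have hpar' : μ ≡ (r : ℤ) - 1 [ZMOD 2] := by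
    rw [Int.modEq_iff_dvd]
    obtain ⟨c, hc⟩ := hpar
    exact ⟨r - 1 - c, by omega⟩
  have hdvd : ∀ x : ℤ, 0 ≤ x → x < w → ((w : ℤ) ∣ x ↔ x = 0) := fun x hx0 hxw =>
    ⟨fun hd => Int.eq_zero_of_dvd_of_nonneg_of_lt hx0 hxw hd, fun hx => hx ▸ dvd_zero _⟩
  simp only [κ, h, a, hpar', true_and, multA, hwv]
  rcases lt_trichotomy (2 * r) u with h1 | h1 | h1
  · simp only [h1, h1.ne, true_or, if_true, false_and, false_or, ne_eq, not_false_eq_true, true_and]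
    split_ifs <;> push_cast <;> ring
  · rcases lt_trichotomy (2 * μ) w with h5 | h5 | h5
    · have e1 := hdvd (2 * μ) (by omega) h5
      have e2 := hdvd μ (by omega) (by omega)
      have e3 : 2 * μ = 0 ↔ μ = 0 := by omega
      simp only [h1, h5, h5.le, e1, e2, e3, lt_irrefl, if_false, if_true, true_and, false_or,
        ne_eq, not_true_eq_false, false_and, or_false]
      split_ifs <;> push_cast <;> ring
    · have e2 := hdvd μ (by omega) (by omega)
      have e3 : μ ≠ 0 := by omega
      simp only [h1, h5, e2, e3, lt_irrefl, if_false, if_true, true_and, dvd_refl, true_or, le_refl,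
        or_true]
      push_cast
      ring
    · have e1 : ¬ 2 * μ < w := by omega
      have e2 : ¬ 2 * μ = w := by omega
      have e3 : ¬ 2 * μ ≤ w := by omega
      simp only [h1, e1, e2, e3, lt_irrefl, if_false, and_false, or_false]
      simp
  · have e1 : ¬ 2 * r < u := by omega
    have e2 : ¬ 2 * r = u := by omega
    simp [e1, e2]

/-! ### Transformations of the eta function -/

lemma eta_neg_one_div_sq {τ : ℂ} (hτ : 0 < τ.im) :
    ModularForm.eta (-1 / τ) ^ 2 = -Complex.I * τ * ModularForm.eta τ ^ 2 := by
  have h := ModularForm.eta_comp_eq_csqrt_I_inv (show τ ∈ UpperHalfPlane.upperHalfPlaneSet from hτ)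
  have hsq : ∀ z : ℂ, Complex.sqrt z ^ 2 = z := fun z => by
    have := Complex.cpow_nat_inv_pow z two_ne_zero
    rwa [Nat.cast_ofNat] at this
  simp only [Function.comp_apply, Pi.smul_apply, Pi.mul_apply, smul_eq_mul] at h
  rw [h, mul_pow, mul_pow, inv_pow, hsq, hsq, Complex.inv_I]
  ring

lemma eta_add_one_sq (τ : ℂ) :
    ModularForm.eta (τ + 1) ^ 2 = addChr 12 1 * ModularForm.eta τ ^ 2 := by
  have h1 : ∀ n, ModularForm.eta_q n (τ + 1) = ModularForm.eta_q n τ := fun n => by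
    rw [ModularForm.eta_q_eq_pow, ModularForm.eta_q_eq_pow, mul_add, mul_one, Complex.exp_add,
      Complex.exp_two_pi_mul_I, mul_one]
  have h2 : Function.Periodic.qParam 24 (τ + 1) ^ 2
      = addChr 12 1 * Function.Periodic.qParam 24 τ ^ 2 := by
    rw [Function.Periodic.qParam, Function.Periodic.qParam, addChr, ← Complex.exp_nat_mul,
      ← Complex.exp_nat_mul, ← Complex.exp_add]
    congr 1
    push_cast
    ring
  simp only [ModularForm.eta, h1, mul_pow, h2, mul_assoc]

/-! ### The weight one parts as quotients of coset theta functions -/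

lemma virChar_eq (hu : 0 < u) (hv : 0 < v) (r s : ℕ) {τ : ℂ} (hτ : 0 < τ.im) :
    virChar u v r s τ = (ModularForm.eta τ)⁻¹ *
      (thetaSeries (u * v) 0 (residueInd (2 * (u * v)) (v * r - u * s)) τ
        - thetaSeries (u * v) 0 (residueInd (2 * (u * v)) (v * r + u * s)) τ) := by
  have hN : 0 < u * v := Nat.mul_pos hu hv
  have hsum : ∀ m : ℤ, Summable fun n : ℤ => gaussTerm (u * v) (m + 2 * (u * v : ℕ) * n) τ := by
    intro m
    simp only [gaussTerm_add hN]
    exact ((summable_jacobiTheta₂_term_iff _ _).mpr (im_two_mul_natCast_mul hN hτ)).mul_left _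
  rw [virChar, thetaSeries_residueInd hN, thetaSeries_residueInd hN]
  simp only [pow_zero, one_mul]
  rw [← (hsum _).tsum_sub (hsum _)]
  congr 1
  refine tsum_congr fun n => ?_
  congr 1 <;>
  · rw [qPow, gaussTerm]
    congr 1
    push_cast
    ring

lemma level_eq (hv : 0 < v) (hwv : wParam u v = w) : level u v = -(w / v) := by
  have hv' : (v : ℝ) ≠ 0 := by exact_mod_cast hv.ne'
  have h : (w : ℝ) = 2 * v - u := by
    have := congrArg (Int.cast (R := ℝ)) hwv
    rw [wParam] at this
    push_cast at this
    exact this.symm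
  rw [level, h]
  field_simp
  ring

/-- The theta function of the lattice `2 w ℤ` at `a = m / v`, in terms of the Jacobi theta
function. -/
lemma latticeTheta_eq (hv : 0 < v) (hw : 0 < w) (hwv : wParam u v = w) (m : ℤ) (ζ τ : ℂ) :
    latticeTheta u v (m / v) ζ τ = gaussTerm (w * v) m τ *
      (Complex.exp (2 * Real.pi * Complex.I * (m / v) * ζ)
        * jacobiTheta₂ (2 * w * ζ + m * τ) (2 * (w * v : ℕ) * τ)) := by
  have hv' : (v : ℂ) ≠ 0 := by exact_mod_cast hv.ne'
  have hw' : (w : ℂ) ≠ 0 := by exact_mod_cast hw.ne'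
  rw [latticeTheta, jacobiTheta₂, ← tsum_mul_left, ← tsum_mul_left, hwv, level_eq hv hwv]
  refine tsum_congr fun n => ?_
  rw [gaussTerm, jacobiTheta₂_term, qPow, ← Complex.exp_add, ← Complex.exp_add, ← Complex.exp_add]
  congr 1
  push_cast
  field_simp
  ring

lemma thetaDeriv_eq (hv : 0 < v) (hw : 0 < w) (hwv : wParam u v = w) (m : ℤ) {τ : ℂ}
    (hτ : 0 < τ.im) :
    thetaDeriv u v (m / v) τ
      = -(2 * (w * v) : ℂ)⁻¹ * thetaSeries (w * v) 1 (residueInd (2 * (w * v)) m) τ := by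
  have hN : 0 < w * v := Nat.mul_pos hw hv
  have hv' : (v : ℂ) ≠ 0 := by exact_mod_cast hv.ne'
  have hw' : (w : ℂ) ≠ 0 := by exact_mod_cast hw.ne'
  have hτ' := im_two_mul_natCast_mul hN hτ
  have hd : HasDerivAt (fun ζ => latticeTheta u v (m / v) ζ τ) (gaussTerm (w * v) m τ *
      (2 * Real.pi * Complex.I * (m / v) * jacobiTheta₂ (m * τ) (2 * (w * v : ℕ) * τ)
        + 2 * w * jacobiTheta₂' (m * τ) (2 * (w * v : ℕ) * τ))) 0 := by
    simp only [latticeTheta_eq hv hw hwv]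
    refine HasDerivAt.const_mul _ ?_
    have e1 : HasDerivAt (fun ζ : ℂ => Complex.exp (2 * Real.pi * Complex.I * (m / v) * ζ))
        (2 * Real.pi * Complex.I * (m / v)) 0 := by
      have := ((hasDerivAt_id (0 : ℂ)).const_mul (2 * Real.pi * Complex.I * (m / v))).cexp
      simpa using this
    have e2 : HasDerivAt (fun ζ : ℂ => 2 * w * ζ + m * τ) (2 * w) 0 := by
      have := ((hasDerivAt_id (0 : ℂ)).const_mul (2 * w : ℂ)).add_const (m * τ)
      simpa using this
    have e3 := hasDerivAt_jacobiTheta₂_fst (2 * w * 0 + m * τ) hτ'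
    refine (e1.mul (e3.comp 0 e2)).congr_deriv ?_
    simp
    ring
  rw [thetaDeriv, hd.deriv, thetaSeries_one_residueInd hN m hτ, hwv]
  have hpi : (Real.pi : ℂ) ≠ 0 := by exact_mod_cast Real.pi_ne_zero
  have hI := Complex.I_ne_zero
  push_cast
  field_simp

/-- The sum over `1 ≤ s ≤ v - 1` is half the sum over `s` modulo `2 v`, because its summand is
even in `s` and vanishes at `s = 0` and `s = v`; the four products then combine in pairs. -/
lemma sum_Icc_eq_oddTheta (hv : 0 < v) (μ r : ℤ) (τ : ℂ) :
    ∑ s ∈ Finset.Icc 1 (v - 1), addChr 2 s *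
      ((thetaSeries (u * v) 0 (residueInd (2 * (u * v)) (v * r - u * s)) τ
        - thetaSeries (u * v) 0 (residueInd (2 * (u * v)) (v * r + u * s)) τ)
      * (thetaSeries (w * v) 1 (residueInd (2 * (w * v)) (v * μ - w * s)) τ
        - thetaSeries (w * v) 1 (residueInd (2 * (w * v)) (v * μ + w * s)) τ))
      = oddTheta u v w μ r τ := by
  let g : ℤ → ℤ → ℂ := fun r s => addChr 2 s *
    (thetaSeries (u * v) 0 (residueInd (2 * (u * v)) (v * r - u * s)) τ
      * thetaSeries (w * v) 1 (residueInd (2 * (w * v)) (v * μ - w * s)) τ)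
  let f : ℤ → ℂ := fun s => addChr 2 s *
      ((thetaSeries (u * v) 0 (residueInd (2 * (u * v)) (v * r - u * s)) τ
        - thetaSeries (u * v) 0 (residueInd (2 * (u * v)) (v * r + u * s)) τ)
      * (thetaSeries (w * v) 1 (residueInd (2 * (w * v)) (v * μ - w * s)) τ
        - thetaSeries (w * v) 1 (residueInd (2 * (w * v)) (v * μ + w * s)) τ))
  have hg : ∀ r, Function.Periodic (g r) (2 * v : ℕ) := fun r =>
    periodic_cosetTheta_summand μ r τ
  have hfg : ∀ s, f s = (g r s + g r (-s)) - (g (-r) s + g (-r) (-s)) := by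
    intro s
    have h1 : addChr 2 (-s) = addChr 2 s := addChr_congr two_pos ⟨-s, by push_cast; ring⟩
    have e1 : (v : ℤ) * -r - u * s = -(v * r + u * s) := by ring
    have e2 : (v : ℤ) * -r - u * -s = -(v * r - u * s) := by ring
    have e3 : (v : ℤ) * r - u * -s = v * r + u * s := by ring
    have e4 : (v : ℤ) * μ - w * -s = v * μ + w * s := by ring
    simp only [f, g, h1, e1, e2, e3, e4, thetaSeries_residueInd_neg]
    ring
  have hper : Function.Periodic f (2 * v : ℕ) := by
    intro s
    have e1 : ∀ r, g r (-(s + (2 * v : ℕ))) = g r (-s) := fun r => by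
      rw [← hg r (-(s + (2 * v : ℕ)))]; congr 1; ring
    rw [hfg, hfg, hg, hg, e1, e1]
  have heven : ∀ s, f (-s) = f s := by
    intro s
    rw [hfg, hfg, neg_neg]
    ring
  have h0 : f 0 = 0 := by simp [f]
  have hfv : f v = 0 := by
    have : residueInd (2 * (u * v)) (v * r - u * v) = residueInd (2 * (u * v)) (v * r + u * v) :=
      residueInd_congr ⟨-1, by push_cast; ring⟩
    simp [f, this]
  have hsum := sum_range_two_mul_of_even hv hper heven
  have hG : ∀ r, ∑ s ∈ Finset.range (2 * v), g r s = cosetTheta u v w μ r τ := fun r => rfl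
  have hG' : ∀ r, ∑ s ∈ Finset.range (2 * v), g r (-s) = cosetTheta u v w μ r τ := fun r => by
    rw [sum_range_neg (by omega) (hg r), hG]
  rw [h0, hfv] at hsum
  simp only [hfg, Finset.sum_sub_distrib, Finset.sum_add_distrib, hG, hG'] at hsum
  rw [← Finset.sum_add_distrib, ← Finset.sum_add_distrib, ← Finset.sum_sub_distrib] at hsum
  simp only [← hfg] at hsum
  change ∑ s ∈ Finset.Icc 1 (v - 1), f s = _
  rw [oddTheta]
  linear_combination -hsum / 2

lemma gammaFn_eq (hu : 0 < u) (hv : 0 < v) (hw : 0 < w) (hwv : wParam u v = w) (μ : ℤ) (r : ℕ)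
    {τ : ℂ} (hτ : 0 < τ.im) :
    gammaFn u v μ r τ = (2 * (w * v) * ModularForm.eta τ ^ 2)⁻¹ * oddTheta u v w μ r τ := by
  have hv' : (v : ℝ) ≠ 0 := by exact_mod_cast hv.ne'
  rw [gammaFn, ← sum_Icc_eq_oddTheta hv, Finset.mul_sum]
  refine Finset.sum_congr rfl fun s hs => ?_
  have hs1 := (Finset.mem_Icc.mp hs).1
  have e1 : (μ + s * level u v : ℝ) = ((v * μ - w * s : ℤ) : ℝ) / v := by
    rw [level_eq hv hwv]; push_cast; field
  have e2 : (μ - s * level u v : ℝ) = ((v * μ + w * s : ℤ) : ℝ) / v := by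
    rw [level_eq hv hwv]; push_cast; field
  have e3 : addChr 2 s = -(-1) ^ (s - 1) := by
    obtain ⟨n, rfl⟩ : ∃ n, s = n + 1 := ⟨s - 1, by omega⟩
    rw [addChr_two_natCast, pow_succ]
    simp
  rw [e1, e2, thetaDeriv_eq hv hw hwv _ hτ, thetaDeriv_eq hv hw hwv _ hτ, virChar_eq hu hv r s hτ,
    e3]
  simp only [div_eq_mul_inv, mul_inv, pow_two]
  ring

/-! ### Modular transformations of the weight one parts -/

lemma odd_of_isLabel {μ : ℤ} {r : ℕ} (h : IsLabel u μ r) : Odd (μ + r) := by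
  obtain ⟨c, hc⟩ := Int.modEq_iff_dvd.mp h.2.2
  exact ⟨r - 1 - c, by omega⟩

lemma sMatrix_eq (hu : 0 < u) (hv : 0 < v) (hw : 0 < w) (hwv : wParam u v = w) (μ : ℤ) (r : ℕ)
    (μ' : ℤ) (r' : ℕ) :
    sMatrix u v μ r μ' r' = 2 * multA u v μ' r' / √(u * w : ℝ)
      * Real.sin (Real.pi * (r * (v * r') : ℤ) / u)
      * Real.cos (Real.pi * (μ * (v * μ') : ℤ) / w) := by
  have hu' : (u : ℝ) ≠ 0 := by exact_mod_cast hu.ne'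
  have hv' : (v : ℝ) ≠ 0 := by exact_mod_cast hv.ne'
  have hw' : (w : ℝ) ≠ 0 := by exact_mod_cast hw.ne'
  have e1 : Real.pi * r * r' / (u / v) = Real.pi * (r * (v * r') : ℤ) / u := by
    push_cast; field
  have e2 : Real.pi * μ * μ' / -(w / v) = -(Real.pi * (μ * (v * μ') : ℤ) / w) := by
    push_cast; field
  rw [sMatrix, level_eq hv hwv, hwv, tParam, e1, e2, Real.cos_neg, Int.cast_natCast]

lemma gammaFn_neg_one_div (hu : 0 < u) (hv : 0 < v) (hw : 0 < w) (huv : Nat.Coprime u v)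
    (huw : u + w = 2 * v) (hwv : wParam u v = w) {μ : ℤ} {r : ℕ} (hμ : Odd (μ + r)) {τ : ℂ}
    (hτ : 0 < τ.im) :
    gammaFn u v μ r (-1 / τ) = -Complex.I * τ * ∑ p ∈ indexSet u v,
      (sMatrix u v μ r p.1 p.2 : ℂ) * gammaFn u v p.1 p.2 τ := by
  have hu0 : (u : ℝ) ≠ 0 := by exact_mod_cast hu.ne'
  have hw0 : (w : ℝ) ≠ 0 := by exact_mod_cast hw.ne'
  -- shifting an angle by an integral multiple of `π`
  have hsin : ∀ (n : ℕ) (k l : ℤ), (n : ℝ) ≠ 0 →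
      Real.sin (Real.pi * (k + l * n : ℤ) / n) = (-1) ^ l * Real.sin (Real.pi * k / n) := by
    intro n k l hn
    rw [← Real.sin_add_int_mul_pi]
    congr 1; push_cast; field
  have hcos : ∀ (n : ℕ) (k l : ℤ), (n : ℝ) ≠ 0 →
      Real.cos (Real.pi * (k + l * n : ℤ) / n) = (-1) ^ l * Real.cos (Real.pi * k / n) := by
    intro n k l hn
    rw [← Real.cos_add_int_mul_pi]
    congr 1; push_cast; field
  have heven : ∀ l : ℤ, ((-1 : ℝ)) ^ (l * 2) = 1 := fun l => by
    rw [mul_comm, zpow_mul]; norm_num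
  have hfold := sum_box_eq_sum_indexSet hu hw hwv (W := sKernel u v w μ r τ)
    (by
      intro r' μ'
      have e1 : (r * (v * (r' + (2 * u : ℕ))) : ℤ) = r * (v * r') + (r * v * 2) * u := by
        push_cast; ring
      have e2 : Odd (μ' + (r' + (2 * u : ℕ))) ↔ Odd (μ' + r') := by push_cast; grind
      simp only [sKernel, e1, e2, hsin _ _ _ hu0, heven, one_mul, oddTheta_add_two_mul_right])
    (by
      intro r' μ'
      have e1 : (μ * (v * (μ' + (2 * w : ℕ))) : ℤ) = μ * (v * μ') + (μ * v * 2) * w := by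
        push_cast; ring
      have e2 : Odd (μ' + (2 * w : ℕ) + r') ↔ Odd (μ' + r') := by push_cast; grind
      simp only [sKernel, e1, e2, hcos _ _ _ hw0, heven, one_mul, oddTheta_add_two_mul_left])
    (by
      intro r' μ'
      have e1 : Real.pi * (r * (v * -r') : ℤ) / u = -(Real.pi * (r * (v * r') : ℤ) / u) := by
        push_cast; ring
      have e2 : Odd (μ' + -r') ↔ Odd (μ' + r') := by grind
      simp only [sKernel, e1, e2, Real.sin_neg, oddTheta_neg_right]
      push_cast
      split_ifs <;> ring)
    (by
      intro r' μ'
      have e1 : Real.pi * (μ * (v * -μ') : ℤ) / w = -(Real.pi * (μ * (v * μ') : ℤ) / w) := by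
        push_cast; ring
      have e2 : Odd (-μ' + r') ↔ Odd (μ' + r') := by grind
      simp only [sKernel, e1, e2, Real.cos_neg, oddTheta_neg_left hv])
    (by
      intro r' μ'
      have e1 : (r * (v * (r' + u)) : ℤ) = r * (v * r') + (r * v) * u := by ring
      have e2 : (μ * (v * (μ' + w)) : ℤ) = μ * (v * μ') + (μ * v) * w := by ring
      have e3 : Odd (μ' + w + (r' + u)) ↔ Odd (μ' + r') := by
        have : (u : ℤ) + w = 2 * v := by exact_mod_cast huw
        rw [show μ' + w + (r' + u) = μ' + r' + 2 * v by linarith]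
        grind
      -- the three signs cancel because `μ + r` is odd
      have e4 : (((-1 : ℝ) ^ (r * v : ℤ) * (-1 : ℝ) ^ (μ * v : ℤ) : ℝ) : ℂ) * addChr 2 v = 1 := by
        obtain ⟨c, hc⟩ := hμ
        have : (r * v + μ * v : ℤ) = v + (c * v) * 2 := by linear_combination (v : ℤ) * hc
        rw [← zpow_add₀ (by norm_num), this, zpow_add₀ (by norm_num), heven, mul_one, zpow_natCast,
          addChr_two_natCast]
        push_cast
        rw [← mul_pow]
        norm_num
      simp only [sKernel, e1, e2, e3, hsin _ _ _ hu0, hcos _ _ _ hw0, oddTheta_add_add hv]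
      split_ifs
      · push_cast at e4 ⊢
        linear_combination (Complex.sin (Real.pi * (r * (v * r')) / u)
          * Complex.cos (Real.pi * (μ * (v * μ')) / w) * oddTheta u v w μ' r' τ) * e4
      · rfl)
    (by
      intro μ'
      simp [sKernel])
    (by
      intro r' μ' h
      simp only [sKernel, if_neg h])
  have hη := ModularForm.eta_ne_zero (show τ ∈ UpperHalfPlane.upperHalfPlaneSet from hτ)
  rw [gammaFn_eq hu hv hw hwv _ _ (im_neg_one_div_pos hτ), eta_neg_one_div_sq hτ,
    oddTheta_inversion hu hv hw huv huw hμ hτ, hfold, Finset.mul_sum, Finset.mul_sum,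
    Finset.mul_sum, Finset.mul_sum]
  refine Finset.sum_congr rfl fun p hp => ?_
  have hodd : Odd (p.1 + p.2) := by
    simp only [indexSet, Finset.mem_filter] at hp
    obtain ⟨c, hc⟩ := Int.modEq_iff_dvd.mp hp.2.1
    exact ⟨p.2 - 1 - c, by omega⟩
  rw [gammaFn_eq hu hv hw hwv _ _ hτ, sMatrix_eq hu hv hw hwv, sKernel, if_pos hodd]
  have hv' : (v : ℂ) ≠ 0 := by exact_mod_cast hv.ne'
  have hw' : (w : ℂ) ≠ 0 := by exact_mod_cast hw.ne'
  have hτ0 := ne_zero_of_im_pos hτ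
  have hI := Complex.I_ne_zero
  have hs : ((√(u * w : ℝ) : ℝ) : ℂ) ≠ 0 := by
    have : 0 < √(u * w : ℝ) := Real.sqrt_pos.mpr (by positivity)
    exact_mod_cast this.ne'
  generalize oddTheta u v w p.1 p.2 τ = A
  generalize Real.sin _ = S
  generalize Real.cos _ = C
  generalize √(u * w : ℝ) = q at *
  push_cast
  field_simp
  rw [Complex.I_sq]
  ring

/-- All summands of a coset theta function acquire the same factor: the exponents depend on `s` only
through `s (s - r - μ) / 2`, which is an integer as `μ + r` is odd. -/
lemma cosetTheta_add_one (hu : 0 < u) (hv : 0 < v) (hw : 0 < w) (huw : u + w = 2 * v) {μ r : ℤ}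
    (hμ : Odd (μ + r)) (τ : ℂ) :
    cosetTheta u v w μ r (τ + 1)
      = addChr (4 * u) (v * r ^ 2) * addChr (4 * w) (v * μ ^ 2) * cosetTheta u v w μ r τ := by
  rw [cosetTheta, cosetTheta, Finset.mul_sum]
  refine Finset.sum_congr rfl fun s _ => ?_
  rw [thetaSeries_residueInd_add_one (Nat.mul_pos hu hv),
    thetaSeries_residueInd_add_one (Nat.mul_pos hw hv)]
  have key : ∀ (n : ℕ) (x : ℤ), 0 < n → addChr (4 * (n * v)) ((v * x - n * s) ^ 2)
      = addChr (4 * n) (v * x ^ 2) * (addChr 2 (-(x * s)) * addChr (4 * v) (n * s ^ 2)) := by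
    intro n x hn
    have e1 : addChr (4 * n) (v * x ^ 2) = addChr (4 * (n * v)) (v * (v * x ^ 2)) := by
      rw [show 4 * (n * v) = v * (4 * n) by ring, addChr_mul_left hv]
    have e2 : addChr 2 (-(x * s)) = addChr (4 * (n * v)) ((2 * (n * v) : ℕ) * (-(x * s))) := by
      rw [show 4 * (n * v) = 2 * (n * v) * 2 by ring, addChr_mul_left (by positivity)]
    have e3 : addChr (4 * v) (n * s ^ 2) = addChr (4 * (n * v)) (n * (n * s ^ 2)) := by
      rw [show 4 * (n * v) = n * (4 * v) by ring, addChr_mul_left hn]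
    rw [e1, e2, e3, ← addChr_add, ← addChr_add]
    congr 1
    push_cast
    ring
  have hone : addChr 2 (-(r * s)) * addChr 2 (-(μ * s)) *
      (addChr (4 * v) (u * s ^ 2) * addChr (4 * v) (w * s ^ 2)) = 1 := by
    have e1 : (u * s ^ 2 + w * s ^ 2 : ℤ) = (2 * v : ℕ) * s ^ 2 := by
      have : (u : ℤ) + w = 2 * v := by exact_mod_cast huw
      push_cast
      linear_combination (s : ℤ) ^ 2 * this
    rw [← addChr_add, ← addChr_add, e1, show 4 * v = 2 * v * 2 by ring,
      addChr_mul_left (by positivity), ← addChr_add]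
    apply addChr_of_dvd two_pos
    obtain ⟨c, hc⟩ := hμ
    obtain ⟨d, hd⟩ := Int.even_mul_succ_self ((s : ℤ) - 1)
    exact ⟨d - c * s, by push_cast; linear_combination hd - (s : ℤ) * hc⟩
  rw [key u r hu, key w μ hw]
  linear_combination (addChr 2 s * (addChr (4 * u) (v * r ^ 2) * addChr (4 * w) (v * μ ^ 2) *
    (thetaSeries (u * v) 0 (residueInd (2 * (u * v)) (v * r - u * s)) τ
      * thetaSeries (w * v) 1 (residueInd (2 * (w * v)) (v * μ - w * s)) τ))) * hone

lemma oddTheta_add_one (hu : 0 < u) (hv : 0 < v) (hw : 0 < w) (huw : u + w = 2 * v) {μ r : ℤ}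
    (hμ : Odd (μ + r)) (τ : ℂ) :
    oddTheta u v w μ r (τ + 1)
      = addChr (4 * u) (v * r ^ 2) * addChr (4 * w) (v * μ ^ 2) * oddTheta u v w μ r τ := by
  have hμ' : Odd (μ + -r) := by grind
  rw [oddTheta, cosetTheta_add_one hu hv hw huw hμ, cosetTheta_add_one hu hv hw huw hμ', neg_sq,
    oddTheta]
  ring

/-- The `T`-eigenvalue is the one read off from the exponents `v r ^ 2 / 4 u` and `v μ ^ 2 / 4 w`
of the coset theta functions and from `η ^ 2`. -/
lemma exp_confWeight (hu : 0 < u) (hv : 0 < v) (hw : 0 < w) (hwv : wParam u v = w) {μ : ℤ} {r : ℕ}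
    (hμ : Odd (μ + r)) :
    Complex.exp (2 * Real.pi * Complex.I *
        ((confWeight u v μ r - centralCharge u v / 24 : ℝ) : ℂ))
      = addChr (4 * u) (v * r ^ 2) * addChr (4 * w) (v * μ ^ 2) * addChr 12 (-1) := by
  have hu' : (u : ℝ) ≠ 0 := by exact_mod_cast hu.ne'
  have hv' : (v : ℝ) ≠ 0 := by exact_mod_cast hv.ne'
  have hw' : (w : ℝ) ≠ 0 := by exact_mod_cast hw.ne'
  -- the conformal weights differ from the leading exponents by integers
  obtain ⟨n, hn⟩ : ∃ n : ℤ, confWeight u v μ r - centralCharge u v / 24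
      = (v * r ^ 2 / (4 * u) + v * μ ^ 2 / (4 * w) - 1 / 12 : ℝ) + n := by
    have hmain : ((r : ℝ) ^ 2 - 1) / (4 * tParam u v) - μ ^ 2 / (4 * level u v)
        - centralCharge u v / 24 = (v * r ^ 2 / (4 * u) + v * μ ^ 2 / (4 * w) - 1 / 12 : ℝ) := by
      rw [centralCharge, level_eq hv hwv, tParam]
      field
    rw [confWeight]
    split_ifs
    · exact ⟨0, by rw [hmain]; simp⟩
    · have : ∃ n : ℤ, |μ| - (r - 1) = 2 * n := by
        obtain ⟨c, hc⟩ := hμ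
        rcases abs_choice μ with h | h
        · exact ⟨c - r + 1, by omega⟩
        · exact ⟨-c, by omega⟩
      obtain ⟨n, hn⟩ := this
      refine ⟨n, ?_⟩
      have hn' : |(μ : ℝ)| - (r - 1) = 2 * n := by exact_mod_cast hn
      rw [hn', ← hmain]
      ring
  rw [hn]
  have hu'' : (u : ℂ) ≠ 0 := by exact_mod_cast hu.ne'
  have hw'' : (w : ℂ) ≠ 0 := by exact_mod_cast hw.ne'
  have e : (2 * Real.pi * Complex.I *
      (((v * r ^ 2 / (4 * u) + v * μ ^ 2 / (4 * w) - 1 / 12 : ℝ) + n : ℝ) : ℂ))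
      = (2 * Real.pi * Complex.I * ((v * r ^ 2 : ℤ) : ℂ) / ((4 * u : ℕ) : ℂ)
        + 2 * Real.pi * Complex.I * ((v * μ ^ 2 : ℤ) : ℂ) / ((4 * w : ℕ) : ℂ)
        + 2 * Real.pi * Complex.I * ((-1 : ℤ) : ℂ) / ((12 : ℕ) : ℂ))
        + n * (2 * Real.pi * Complex.I) := by
    push_cast
    field
  rw [e, Complex.exp_add, Complex.exp_int_mul_two_pi_mul_I, mul_one, Complex.exp_add,
    Complex.exp_add]
  rfl

lemma gammaFn_add_one (hu : 0 < u) (hv : 0 < v) (hw : 0 < w)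
    (huw : u + w = 2 * v) (hwv : wParam u v = w) {μ : ℤ} {r : ℕ} (hμ : Odd (μ + r)) {τ : ℂ}
    (hτ : 0 < τ.im) :
    gammaFn u v μ r (τ + 1) = Complex.exp (2 * Real.pi * Complex.I *
        ((confWeight u v μ r - centralCharge u v / 24 : ℝ) : ℂ)) * gammaFn u v μ r τ := by
  have hτ' : 0 < (τ + 1).im := by simpa using hτ
  have h12 : addChr 12 1 * addChr 12 (-1) = 1 := by
    rw [← addChr_add]
    exact addChr_of_dvd (by norm_num) ⟨0, rfl⟩
  have h12' : (addChr 12 1)⁻¹ = addChr 12 (-1) := inv_eq_of_mul_eq_one_right h12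
  have hμ' : Odd (μ + (r : ℤ)) := hμ
  rw [exp_confWeight hu hv hw hwv hμ, gammaFn_eq hu hv hw hwv _ _ hτ,
    gammaFn_eq hu hv hw hwv _ _ hτ', eta_add_one_sq, oddTheta_add_one hu hv hw huw hμ', ← h12']
  simp only [mul_inv]
  ring

/-! ### Holomorphy and growth -/

lemma oddTheta_eq_doubleTheta (hu : 0 < u) (hv : 0 < v) (hw : 0 < w) (μ r : ℤ) {τ : ℂ}
    (hτ : 0 < τ.im) :
    oddTheta u v w μ r τ = doubleTheta (u * v) (w * v) (thetaCoeff u v w μ r) τ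
      - doubleTheta (u * v) (w * v) (thetaCoeff u v w μ (-r)) τ := by
  rw [oddTheta, cosetTheta_eq_doubleTheta hu hv hw _ _ hτ,
    cosetTheta_eq_doubleTheta hu hv hw _ _ hτ]

lemma mdifferentiable_gammaFn (hu : 0 < u) (hv : 0 < v) (hw : 0 < w) (hwv : wParam u v = w)
    (μ : ℤ) (r : ℕ) : MDifferentiable 𝓘(ℂ) 𝓘(ℂ) (fun τ : ℍ => gammaFn u v μ r τ) := by
  rw [UpperHalfPlane.mdifferentiable_iff]
  have hM : 0 < u * v := Nat.mul_pos hu hv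
  have hN : 0 < w * v := Nat.mul_pos hw hv
  have h : DifferentiableOn ℂ (fun τ => (2 * (w * v) * ModularForm.eta τ ^ 2)⁻¹ *
      (doubleTheta (u * v) (w * v) (thetaCoeff u v w μ r) τ
      - doubleTheta (u * v) (w * v) (thetaCoeff u v w μ (-r)) τ)) {z | 0 < z.im} := by
    intro z hz
    have hη := ModularForm.eta_ne_zero (show z ∈ UpperHalfPlane.upperHalfPlaneSet from hz)
    have hd := ModularForm.differentiableAt_eta_of_mem_upperHalfPlaneSet
      (show z ∈ UpperHalfPlane.upperHalfPlaneSet from hz)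
    have hv' : (v : ℂ) ≠ 0 := by exact_mod_cast hv.ne'
    have hw' : (w : ℂ) ≠ 0 := by exact_mod_cast hw.ne'
    refine DifferentiableAt.differentiableWithinAt (DifferentiableAt.mul ?_ (DifferentiableAt.sub
      (differentiableAt_doubleTheta hM hN (norm_thetaCoeff_le u v w μ r) hz)
      (differentiableAt_doubleTheta hM hN (norm_thetaCoeff_le u v w μ (-r)) hz)))
    refine DifferentiableAt.inv ((hd.pow 2).const_mul _) ?_
    simp [hv', hw', hη]
  refine h.congr fun z hz => ?_
  have hz' : 0 < z.im := hz
  rw [Function.comp_apply, UpperHalfPlane.ofComplex_apply_of_im_pos hz']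
  change gammaFn u v μ r z = _
  rw [gammaFn_eq hu hv hw hwv _ _ hz', oddTheta_eq_doubleTheta hu hv hw _ _ hz']

lemma isBigO_gammaFn (hu : 0 < u) (hv : 0 < v) (hw : 0 < w) (hwv : wParam u v = w)
    (μ : ℤ) (r : ℕ) : (fun τ : ℍ => gammaFn u v μ r τ) =O[UpperHalfPlane.atImInfty]
      fun τ : ℍ => Real.exp (2 * Real.pi * τ.im) := by
  have hM : 0 < u * v := Nat.mul_pos hu hv
  have hN : 0 < w * v := Nat.mul_pos hw hv
  obtain ⟨B₁, h₁⟩ := exists_norm_doubleTheta_le hM hN (norm_thetaCoeff_le u v w μ r)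
  obtain ⟨B₂, h₂⟩ := exists_norm_doubleTheta_le hM hN (norm_thetaCoeff_le u v w μ (-r))
  obtain ⟨K, hK⟩ := ModularForm.exp_isBigO_discriminant.bound
  have him : ∀ᶠ τ : ℍ in UpperHalfPlane.atImInfty, 1 ≤ τ.im :=
    (UpperHalfPlane.atImInfty_mem _).mpr ⟨1, fun _ h => h⟩
  refine Asymptotics.IsBigO.of_bound (‖(2 * (w * v) : ℂ)⁻¹‖ * (1 + K) * (B₁ + B₂)) ?_
  filter_upwards [hK, him] with τ hτK hτ
  have hη : 0 < ‖ModularForm.eta τ‖ := norm_pos_iff.mpr (ModularForm.eta_ne_zero τ.2)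
  have hB : ‖oddTheta u v w μ r τ‖ ≤ B₁ + B₂ := by
    rw [oddTheta_eq_doubleTheta hu hv hw _ _ τ.2]
    exact (norm_sub_le _ _).trans (add_le_add (h₁ _ hτ) (h₂ _ hτ))
  have hE : (‖ModularForm.eta τ‖ ^ 2)⁻¹ ≤ (1 + K) * Real.exp (2 * Real.pi * τ.im) := by
    -- `x⁻² ≤ 1 + x⁻²⁴`, and the discriminant is the 24th power of the eta function
    rw [Real.norm_of_nonneg (Real.exp_pos _).le, ModularForm.discriminant, norm_pow] at hτK
    set x := ‖ModularForm.eta τ‖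
    have e1 : (x ^ 2)⁻¹ ≤ 1 + (x ^ 24)⁻¹ := by
      rcases le_total 1 x with h | h
      · have := inv_le_one_of_one_le₀ (one_le_pow₀ h : 1 ≤ x ^ 2)
        have : 0 ≤ (x ^ 24)⁻¹ := by positivity
        linarith
      · have : (x ^ 2)⁻¹ ≤ (x ^ 24)⁻¹ :=
          inv_anti₀ (by positivity) (pow_le_pow_of_le_one hη.le h (by norm_num))
        linarith
    have e2 : (x ^ 24)⁻¹ ≤ K * Real.exp (2 * Real.pi * τ.im) := by
      rw [inv_le_iff_one_le_mul₀ (by positivity)]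
      have e3 : Real.exp (2 * Real.pi * τ.im) * Real.exp (-2 * Real.pi * τ.im) = 1 := by
        rw [← Real.exp_add]; simp
      calc (1 : ℝ) = Real.exp (2 * Real.pi * τ.im) * Real.exp (-2 * Real.pi * τ.im) := e3.symm
        _ ≤ Real.exp (2 * Real.pi * τ.im) * (K * x ^ 24) := by gcongr
        _ = _ := by ring
    have e4 : 1 ≤ Real.exp (2 * Real.pi * τ.im) := Real.one_le_exp (by positivity)
    linarith
  rw [gammaFn_eq hu hv hw hwv _ _ τ.2, Real.norm_of_nonneg (Real.exp_pos _).le, mul_inv, norm_mul,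
    norm_mul, norm_inv (_ ^ 2), norm_pow]
  calc _ ≤ ‖(2 * (w * v) : ℂ)⁻¹‖ * ((1 + K) * Real.exp (2 * Real.pi * τ.im)) * (B₁ + B₂) := by
        gcongr
        exact mul_nonneg (norm_nonneg _) ((inv_nonneg.mpr (by positivity)).trans hE)
    _ = _ := by ring

/-! ### Spaces of functions stable under the modular group -/

/-- The slash operator of weight `k` as a linear map. -/
def slashLin (k : ℤ) (γ : SL(2, ℤ)) : (ℍ → ℂ) →ₗ[ℂ] (ℍ → ℂ) where
  toFun f := f ∣[k] γ
  map_add' f g := SlashAction.add_slash k γ f g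
  map_smul' c f := ModularForm.SL_smul_slash k γ f c

lemma slashLin_apply (k : ℤ) (γ : SL(2, ℤ)) (f : ℍ → ℂ) : slashLin k γ f = f ∣[k] γ := rfl

lemma slashLin_injective (k : ℤ) (γ : SL(2, ℤ)) : Function.Injective (slashLin k γ) := by
  intro f g h
  have := congrArg (fun f => f ∣[k] γ⁻¹) h
  simpa only [slashLin_apply, ← SlashAction.slash_mul, mul_inv_cancel, SlashAction.slash_one]
    using this

/-- A finite-dimensional space stable under slashing by `S` and `T` is stable under the whole
modular group: slashing is injective, hence surjective on the space, so inverses preserve it. -/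
lemma slash_mem_of_slash_S_T {k : ℤ} {V : Submodule ℂ (ℍ → ℂ)} [FiniteDimensional ℂ V]
    (hS : ∀ f ∈ V, f ∣[k] ModularGroup.S ∈ V) (hT : ∀ f ∈ V, f ∣[k] ModularGroup.T ∈ V)
    (γ : SL(2, ℤ)) : ∀ f ∈ V, f ∣[k] γ ∈ V := by
  have hγ : γ ∈ Subgroup.closure {ModularGroup.S, ModularGroup.T} := by
    rw [SpecialLinearGroup.SL2Z_generators]; trivial
  induction hγ using Subgroup.closure_induction with
  | mem x hx =>
    rcases hx with rfl | rfl
    · exact hS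
    · exact hT
  | one => intro f hf; rwa [SlashAction.slash_one]
  | mul x y _ _ hx hy => intro f hf; rw [SlashAction.slash_mul]; exact hy _ (hx f hf)
  | inv x _ hx =>
    intro f hf
    have hle : V.map (slashLin k x) ≤ V := by
      rintro _ ⟨g, hg, rfl⟩
      exact hx g hg
    have heq : V.map (slashLin k x) = V :=
      Submodule.eq_of_le_of_finrank_eq hle
        (Submodule.equivMapOfInjective _ (slashLin_injective k x) V).finrank_eq.symm
    rw [← heq] at hf
    obtain ⟨g, hg, rfl⟩ := hf
    rwa [slashLin_apply, ← SlashAction.slash_mul, mul_inv_cancel, SlashAction.slash_one]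

/-- A basis of a space of functions stable under slashing transforms by a matrix representation. -/
lemma exists_slash_eq_sum {n : ℕ} {k : ℤ} {V : Submodule ℂ (ℍ → ℂ)}
    (b : Module.Basis (Fin n) ℂ V) (hV : ∀ γ : SL(2, ℤ), ∀ f ∈ V, f ∣[k] γ ∈ V) :
    ∃ ρ : SL(2, ℤ) →* GL (Fin n) ℂ, ∀ (γ : SL(2, ℤ)) (i : Fin n),
      (b i : ℍ → ℂ) ∣[k] γ = ∑ j, (ρ γ : Matrix (Fin n) (Fin n) ℂ) i j • (b j : ℍ → ℂ) := by
  let M : SL(2, ℤ) → Matrix (Fin n) (Fin n) ℂ := fun γ i j =>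
    b.repr ⟨(b i : ℍ → ℂ) ∣[k] γ, hV γ _ (b i).2⟩ j
  have hM : ∀ γ i, (b i : ℍ → ℂ) ∣[k] γ = ∑ j, M γ i j • (b j : ℍ → ℂ) := by
    intro γ i
    have := congrArg V.subtype (b.sum_repr ⟨(b i : ℍ → ℂ) ∣[k] γ, hV γ _ (b i).2⟩)
    rw [map_sum] at this
    simp only [map_smul, Submodule.subtype_apply] at this
    exact this.symm
  have huniq : ∀ A B : Matrix (Fin n) (Fin n) ℂ,
      (∀ i, ∑ j, A i j • (b j : ℍ → ℂ) = ∑ j, B i j • (b j : ℍ → ℂ)) → A = B := by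
    intro A B h
    ext i j
    have h' : ∑ j, A i j • b j = ∑ j, B i j • b j := Subtype.ext (by simpa using h i)
    have := congrArg (fun x => b.repr x j) h'
    simpa [Finsupp.single_apply] using this
  let φ : SL(2, ℤ) →* Matrix (Fin n) (Fin n) ℂ :=
    { toFun := M
      map_one' := by
        apply huniq
        intro i
        rw [← hM, SlashAction.slash_one]
        simp [Matrix.one_apply]
      map_mul' := by
        intro x y
        apply huniq
        intro i
        rw [← hM, SlashAction.slash_mul, hM x i]
        have : (∑ j, M x i j • (b j : ℍ → ℂ)) ∣[k] y = ∑ j, M x i j • ((b j : ℍ → ℂ) ∣[k] y) := by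
          simp only [← slashLin_apply, map_sum, map_smul]
        rw [this]
        simp only [hM y, Matrix.mul_apply, Finset.sum_smul, Finset.smul_sum, smul_smul]
        exact Finset.sum_comm }
  exact ⟨φ.toHomUnits, fun γ i => hM γ i⟩

/-! ### The space spanned by the weight one parts -/

lemma mem_gammaSpace {μ : ℤ} {r : ℕ} (h : IsLabel u μ r) :
    (fun τ : ℍ => gammaFn u v μ r τ) ∈ gammaSpace u v :=
  Submodule.subset_span ⟨μ, r, h, rfl⟩

lemma isLabel_of_mem_indexSet {p : ℤ × ℕ} (hp : p ∈ indexSet u v) : IsLabel u p.1 p.2 := by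
  simp only [indexSet, Finset.mem_filter, Finset.mem_product, Finset.mem_Icc] at hp
  exact ⟨hp.1.2.1, hp.1.2.2, hp.2.1⟩

lemma gammaFn_slash_S (hu : 0 < u) (hv : 0 < v) (hw : 0 < w) (huv : Nat.Coprime u v)
    (huw : u + w = 2 * v) (hwv : wParam u v = w) {μ : ℤ} {r : ℕ} (h : IsLabel u μ r) :
    (fun τ : ℍ => gammaFn u v μ r τ) ∣[(1 : ℤ)] ModularGroup.S
      = ∑ p ∈ indexSet u v, (-Complex.I * sMatrix u v μ r p.1 p.2) •
        (fun τ : ℍ => gammaFn u v p.1 p.2 τ) := by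
  ext τ
  have hτ0 : (τ : ℂ) ≠ 0 := ne_zero_of_im_pos τ.2
  have e : (((-(τ : ℂ))⁻¹ : ℂ)) = -1 / τ := by rw [inv_neg, neg_div, one_div]
  rw [ModularForm.SL_slash_apply, ModularGroup.denom_S, UpperHalfPlane.modular_S_smul]
  change gammaFn u v μ r ((-(τ : ℂ))⁻¹) * _ = _
  rw [e, gammaFn_neg_one_div hu hv hw huv huw hwv (odd_of_isLabel h) τ.2, Finset.sum_apply,
    zpow_neg, zpow_one, Finset.mul_sum, Finset.sum_mul]
  refine Finset.sum_congr rfl fun p _ => ?_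
  rw [Pi.smul_apply, smul_eq_mul]
  field_simp

lemma gammaFn_slash_T (hu : 0 < u) (hv : 0 < v) (hw : 0 < w)
    (huw : u + w = 2 * v) (hwv : wParam u v = w) {μ : ℤ} {r : ℕ} (h : IsLabel u μ r) :
    (fun τ : ℍ => gammaFn u v μ r τ) ∣[(1 : ℤ)] ModularGroup.T
      = Complex.exp (2 * Real.pi * Complex.I *
        ((confWeight u v μ r - centralCharge u v / 24 : ℝ) : ℂ)) •
        (fun τ : ℍ => gammaFn u v μ r τ) := by
  ext τ
  have e : ((ModularGroup.T • τ : ℍ) : ℂ) = τ + 1 := by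
    rw [UpperHalfPlane.modular_T_smul, UpperHalfPlane.coe_vadd, add_comm]; simp
  rw [ModularForm.SL_slash_apply, Pi.smul_apply, smul_eq_mul,
    ← gammaFn_add_one hu hv hw huw hwv (odd_of_isLabel h) τ.2, e]
  rw [UpperHalfPlane.denom]
  simp [ModularGroup.coe_T]

/-- The image of the space under slashing by `S` is spanned by the functions labelled by the index
set; since slashing is injective, this bounds the dimension. -/
lemma gammaSpace_finiteDimensional (hu : 0 < u) (hv : 0 < v) (hw : 0 < w) (huv : Nat.Coprime u v)
    (huw : u + w = 2 * v) (hwv : wParam u v = w) :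
    FiniteDimensional ℂ (gammaSpace u v) ∧
      Module.finrank ℂ (gammaSpace u v) ≤ (indexSet u v).card := by
  classical
  let B : Finset (ℍ → ℂ) := (indexSet u v).image fun p => fun τ : ℍ => gammaFn u v p.1 p.2 τ
  let W : Submodule ℂ (ℍ → ℂ) := Submodule.span ℂ (B : Set (ℍ → ℂ))
  have hle : (gammaSpace u v).map (slashLin 1 ModularGroup.S) ≤ W := by
    rw [gammaSpace, Submodule.map_span, Submodule.span_le]
    rintro _ ⟨_, ⟨μ, r, h, rfl⟩, rfl⟩
    rw [slashLin_apply, gammaFn_slash_S hu hv hw huv huw hwv h]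
    refine Submodule.sum_mem _ fun p hp => Submodule.smul_mem _ _ (Submodule.subset_span ?_)
    exact Finset.mem_coe.mpr (Finset.mem_image_of_mem _ hp)
  have hmaps : ∀ f ∈ gammaSpace u v, slashLin 1 ModularGroup.S f ∈ W := fun f hf =>
    hle ⟨f, hf, rfl⟩
  have hinj : Function.Injective ((slashLin 1 ModularGroup.S).restrict hmaps) := by
    intro f g h
    exact Subtype.ext (slashLin_injective 1 _ (congrArg Subtype.val h))
  have hWfd : FiniteDimensional ℂ W := FiniteDimensional.span_finset ℂ B
  refine ⟨FiniteDimensional.of_injective _ hinj, ?_⟩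
  exact (LinearMap.finrank_le_finrank_of_injective hinj).trans
    ((finrank_span_finset_le_card B).trans Finset.card_image_le)

lemma gammaSpace_slash_mem (hu : 0 < u) (hv : 0 < v) (hw : 0 < w) (huv : Nat.Coprime u v)
    (huw : u + w = 2 * v) (hwv : wParam u v = w) (γ : SL(2, ℤ)) :
    ∀ f ∈ gammaSpace u v, f ∣[(1 : ℤ)] γ ∈ gammaSpace u v := by
  have := (gammaSpace_finiteDimensional hu hv hw huv huw hwv).1
  have key : ∀ A : SL(2, ℤ), (∀ μ r, IsLabel u μ r →
      (fun τ : ℍ => gammaFn u v μ r τ) ∣[(1 : ℤ)] A ∈ gammaSpace u v) →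
      ∀ f ∈ gammaSpace u v, f ∣[(1 : ℤ)] A ∈ gammaSpace u v := by
    intro A hA f hf
    have hle : (gammaSpace u v).map (slashLin 1 A) ≤ gammaSpace u v := by
      nth_rewrite 1 [gammaSpace]
      rw [Submodule.map_span, Submodule.span_le]
      rintro _ ⟨_, ⟨μ, r, h, rfl⟩, rfl⟩
      exact hA μ r h
    exact hle ⟨f, hf, rfl⟩
  refine slash_mem_of_slash_S_T (key _ fun μ r h => ?_) (key _ fun μ r h => ?_) γ
  · rw [gammaFn_slash_S hu hv hw huv huw hwv h]
    exact Submodule.sum_mem _ fun p hp =>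
      Submodule.smul_mem _ _ (mem_gammaSpace (isLabel_of_mem_indexSet hp))
  · rw [gammaFn_slash_T hu hv hw huw hwv h]
    exact Submodule.smul_mem _ _ (mem_gammaSpace h)

lemma mdifferentiable_of_mem_gammaSpace (hu : 0 < u) (hv : 0 < v) (hw : 0 < w)
    (hwv : wParam u v = w) {f : ℍ → ℂ} (hf : f ∈ gammaSpace u v) :
    MDifferentiable 𝓘(ℂ) 𝓘(ℂ) f := by
  induction hf using Submodule.span_induction with
  | mem x hx =>
    obtain ⟨μ, r, -, rfl⟩ := hx
    exact mdifferentiable_gammaFn hu hv hw hwv μ r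
  | zero => exact mdifferentiable_const
  | add x y _ _ hx hy => exact hx.add hy
  | smul a x _ hx => exact hx.const_smul a

lemma isBigO_of_mem_gammaSpace (hu : 0 < u) (hv : 0 < v) (hw : 0 < w)
    (hwv : wParam u v = w) {f : ℍ → ℂ} (hf : f ∈ gammaSpace u v) :
    f =O[UpperHalfPlane.atImInfty] fun τ : ℍ => Real.exp (2 * Real.pi * τ.im) := by
  induction hf using Submodule.span_induction with
  | mem x hx =>
    obtain ⟨μ, r, -, rfl⟩ := hx
    exact isBigO_gammaFn hu hv hw hwv μ r
  | zero => exact Asymptotics.isBigO_zero _ _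
  | add x y _ _ hx hy => exact hx.add hy
  | smul a x _ hx => exact hx.const_smul_left a

end LogParafermion

end

theorem mainTheorem1 (u v : ℕ) (hu : 2 ≤ u) (hv : 1 ≤ v) (huv : Nat.Coprime u v)
    (hk : LogParafermion.level u v < 0) :
    -- the weight one parts span a finite-dimensional vector-valued modular form of weight one
    FiniteDimensional ℂ (LogParafermion.gammaSpace u v) ∧
    Module.finrank ℂ (LogParafermion.gammaSpace u v) ≤ (LogParafermion.indexSet u v).card ∧
    (∀ (n : ℕ) (b : Module.Basis (Fin n) ℂ (LogParafermion.gammaSpace u v)),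
      ∃ ρ : SL(2, ℤ) →* GL (Fin n) ℂ,
        LogParafermion.IsVectorValuedModularForm 1 ρ (fun i => (b i : ℍ → ℂ))) ∧
    -- the modular S- and T-transforms
    (∀ (μ : ℤ) (r : ℕ), LogParafermion.IsLabel u μ r → ∀ τ : ℍ,
      LogParafermion.gammaFn u v μ r (-1 / (τ : ℂ)) =
        -Complex.I * τ * ∑ p ∈ LogParafermion.indexSet u v,
          (LogParafermion.sMatrix u v μ r p.1 p.2 : ℂ) * LogParafermion.gammaFn u v p.1 p.2 τ ∧
      LogParafermion.gammaFn u v μ r ((τ : ℂ) + 1) =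
        Complex.exp (2 * Real.pi * Complex.I *
          ((LogParafermion.confWeight u v μ r - LogParafermion.centralCharge u v / 24 : ℝ) : ℂ))
          * LogParafermion.gammaFn u v μ r τ) := by
  have hu0 : 0 < u := by omega
  have hlt : u < 2 * v := by
    have hv' : (0 : ℝ) < v := by exact_mod_cast hv
    have h1 : (u : ℝ) / v < 2 := by rw [LogParafermion.level] at hk; linarith
    rw [div_lt_iff₀ hv'] at h1
    exact_mod_cast h1
  obtain ⟨w, huw⟩ : ∃ w, u + w = 2 * v := ⟨2 * v - u, by omega⟩
  have hw : 0 < w := by omega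
  have hwv : LogParafermion.wParam u v = w := by rw [LogParafermion.wParam]; omega
  obtain ⟨hfd, hrank⟩ :=
    LogParafermion.gammaSpace_finiteDimensional hu0 hv hw huv huw hwv
  refine ⟨hfd, hrank, fun n b => ?_, fun μ r h τ => ⟨?_, ?_⟩⟩
  · obtain ⟨ρ, hρ⟩ := LogParafermion.exists_slash_eq_sum b
      (LogParafermion.gammaSpace_slash_mem hu0 hv hw huv huw hwv)
    exact ⟨ρ, fun i => LogParafermion.mdifferentiable_of_mem_gammaSpace hu0 hv hw hwv (b i).2,
      fun i => ⟨_, LogParafermion.isBigO_of_mem_gammaSpace hu0 hv hw hwv (b i).2⟩, hρ⟩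
  · exact LogParafermion.gammaFn_neg_one_div hu0 hv hw huv huw hwv
      (LogParafermion.odd_of_isLabel h) τ.2
  · exact LogParafermion.gammaFn_add_one hu0 hv hw huw hwv (LogParafermion.odd_of_isLabel h) τ.2
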